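/- Let $n\ge 1$, $N=2^n$, and let $H=H_N$ be the normalized Hadamard matrix, indexed by $\{0,1\}^n$, $H_{ij}=(-1)^{i\cdot j}/\sqrt N$. For a positive semidefinite real $N\times N$ matrix $\Sigma$ consider two laws of $(X,Y)\in\mathbb R^{2N}$. Yes: $X\sim\mathcal N(0,\Sigma)$ and $Y=HX$. No: $X\sim\mathcal N(0,\Sigma)$ and $Y\sim\mathcal N(0,H\Sigma H)$ are independent. In both cases put $Y'_i=Y_i^2-\mathbb E[Y_i^2]$. The truncated yes and no distributions $\mathscr G$ and $\mathscr U$ of SquaredForrelation($\Sigma$) on $\{\pm1\}^{2N}$ are obtained by drawing $z=(X,Y')$ from the respective law and then setting, independently for each $k\in[2N]$, the $k$-th bit to $1$ with probability $\frac{1+\operatorname{trnc}(z_k)}2$ and to $-1$ with probability $\frac{1-\operatorname{trnc}(z_k)}2$, where $\operatorname{trnc}(a)=\min(1,\max(-1,a))$. For $f:\{\pm1\}^{2N}\to\mathbb R$ with multilinear (Fourier) expansion $f(z)=\sum_{T\subseteq[2N]}\hat f(T)\prod_{k\in T}z_k$, let $L_{1,2}(f)=\sum_{|T|=2}|\hat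 f(T)|$. For a restriction $\rho\in\{\pm1,*\}^{2N}$ let $f_\rho$ be $f$ with every coordinate $k$ such that $\rho_k\neq *$ fixed to $\rho_k$. There is a universal constant $c_0>0$ such that for every $C>0$ there is a constant $K>0$, depending only on $C$, with the following property. Let $c_1\ge c_0$, $n\ge1$, $N=2^n$, $\epsilon_0=\frac1{c_1n}$, $0<m\le\frac12$, and let $\Sigma$ be a positive semidefinite real $N\times N$ matrix with $$|(\Sigma H)_{ij}|\le\frac{C\epsilon_0}{N^m},\qquad |\Sigma_{ij}|\le\epsilon_0,\qquad |(H\Sigma H)_{ij}|\le\epsilon_0\qquad\text{for all } i,j.$$ Let $F:\{\pm1\}^{2N}\to\{\pm1\}$ and $l\in\mathbb R$ be such that $L_{1,2}(F_\rho)\le l$ for every restriction $\rho$. Then $$\Bigl|\mathbb E_{z\sim\mathscr G}[F(z)]-\mathbb E_{z\sim\mathscr U}[F(z)]\Bigr|\le K\,\frac{\epsilon_0\,l}{N^m}.$$ -/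

import Mathlib

open MeasureTheory ProbabilityTheory Matrix

noncomputable section

/-! ## The cube `{±1}^ι`, Fourier coefficients and restrictions

The two-element group `ℤˣ = {1, -1}` plays the role of `{±1}`. -/

/-- The discrete cube `{±1}^ι`. -/
abbrev SignCube (ι : Type*) : Type _ := ι → ℤˣ

instance measurableSingletonClass_sign : MeasurableSingletonClass ℤˣ where
  measurableSet_singleton s := by
    refine ⟨{(s : ℤ)}, measurableSet_singleton _, ?_⟩
    ext t
    simp [Units.ext_iff]

/-- The Fourier coefficient `f̂(T) = E_z [f(z) ∏_{i ∈ T} z_i]` (`z` uniform on the cube), that is,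
the coefficient of `∏_{i ∈ T} z_i` in the unique multilinear polynomial that agrees with `f` on
the cube. -/
def cubeFourierCoeff {ι : Type*} [Fintype ι] [DecidableEq ι] (f : SignCube ι → ℝ) (T : Finset ι) : ℝ :=
  (∑ z : SignCube ι, f z * ∏ i ∈ T, ((z i : ℤ) : ℝ)) / 2 ^ Fintype.card ι

/-- `L_{1,k}(f) = ∑_{|T| = k} |f̂(T)|`, the `ℓ₁`-mass of the level-`k` Fourier coefficients. -/
def levelMass {ι : Type*} [Fintype ι] [DecidableEq ι] (k : ℕ) (f : SignCube ι → ℝ) : ℝ :=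
  ∑ T ∈ (Finset.univ : Finset ι).powersetCard k, |cubeFourierCoeff f T|

/-- The restriction `f_ρ` for `ρ ∈ {±1, *}^ι`: coordinates with `ρ i = some s` are fixed to `s`,
those with `ρ i = none` stay free. The restricted function is still regarded as a function on the
whole cube; it does not depend on the fixed coordinates. -/
def restrictBy {ι : Type*} {β : Type*} (f : SignCube ι → β) (ρ : ι → Option ℤˣ) :
    SignCube ι → β :=
  fun z => f (fun i => (ρ i).getD (z i))

/-! ## Truncation and rounding -/

/-- `trnc(a) = min(1, max(-1, a))`. -/
def trnc (a : ℝ) : ℝ := min 1 (max (-1) a)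

lemma trnc_mem (a : ℝ) : -1 ≤ trnc a ∧ trnc a ≤ 1 :=
  ⟨le_min (by norm_num) (le_max_left _ _), min_le_left _ _⟩

lemma measurable_trnc : Measurable trnc := by unfold trnc; fun_prop

/-- The law on `{±1}` with `P(1) = (1 + trnc a) / 2` and `P(-1) = (1 - trnc a) / 2`. -/
def signLaw (a : ℝ) : Measure ℤˣ :=
  ENNReal.ofReal ((1 + trnc a) / 2) • Measure.dirac 1 +
    ENNReal.ofReal ((1 - trnc a) / 2) • Measure.dirac (-1)

instance isProbabilityMeasure_signLaw (a : ℝ) : IsProbabilityMeasure (signLaw a) := by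
  obtain ⟨h1, h2⟩ := trnc_mem a
  refine ⟨?_⟩
  simp only [signLaw, Measure.coe_add, Measure.coe_smul, Pi.add_apply, Pi.smul_apply,
    measure_univ, smul_eq_mul, mul_one]
  rw [← ENNReal.ofReal_add (by linarith) (by linarith)]
  norm_num [← add_div]

lemma measurable_signLaw : Measurable signLaw := by
  refine Measure.measurable_of_measurable_coe _ fun s _ => ?_
  have := measurable_trnc
  simp only [signLaw, Measure.coe_add, Measure.coe_smul, Pi.add_apply, Pi.smul_apply, smul_eq_mul]
  fun_prop

/-- Truncate every coordinate of `z` to `[-1, 1]` and round the coordinates, independently, to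
`±1` with the truncated values as means. -/
def roundLaw {ι : Type*} [Fintype ι] (z : ι → ℝ) : Measure (SignCube ι) :=
  Measure.pi fun i => signLaw (z i)

instance isProbabilityMeasure_roundLaw {ι : Type*} [Fintype ι] (z : ι → ℝ) :
    IsProbabilityMeasure (roundLaw z) := by unfold roundLaw; infer_instance

lemma measurable_roundLaw {ι : Type*} [Fintype ι] :
    Measurable (roundLaw : (ι → ℝ) → Measure (SignCube ι)) := by
  classical
  refine Measure.measurable_of_measurable_coe _ fun s _ => ?_
  have h : ∀ z : ι → ℝ, roundLaw z s = ∑ w ∈ s.toFinite.toFinset, ∏ i, signLaw (z i) {w i} := by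
    intro z
    have hs : s = (s.toFinite.toFinset : Set (SignCube ι)) := by simp
    conv_lhs => rw [hs, ← sum_measure_singleton]
    refine Finset.sum_congr rfl fun w _ => ?_
    rw [roundLaw, ← Set.univ_pi_singleton, Measure.pi_pi]
  simp_rw [h]
  refine Finset.measurable_sum _ fun w _ => Finset.measurable_prod _ fun i _ => ?_
  exact (Measure.measurable_coe (measurableSet_singleton (w i))).comp
    (measurable_signLaw.comp (measurable_pi_apply i))

/-- The truncated version, on `{±1}^ι`, of a law on `ℝ^ι`: draw `z`, then truncate and round. -/
def truncated {ι : Type*} [Fintype ι] (μ : Measure (ι → ℝ)) : Measure (SignCube ι) :=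
  μ.bind roundLaw

/-! ## The distributions of `SQUAREDFORRELATION(S)`

Coordinates in `[N]`, `N = 2 ^ n`, are indexed by bit strings `Fin n → Bool`; coordinates in
`[2N]` by `(Fin n → Bool) ⊕ (Fin n → Bool)`, the first copy carrying `x` and the second one `y`. -/

/-- The normalised `N × N` Hadamard matrix, `H_{ij} = (-1)^{i · j} / √N` with `N = 2 ^ n`. -/
def hadamardMatrix (n : ℕ) : Matrix (Fin n → Bool) (Fin n → Bool) ℝ :=
  Matrix.of fun i j =>
    (-1 : ℝ) ^ (Finset.univ.filter fun k => i k = true ∧ j k = true).card / √((2 : ℝ) ^ n)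

/-- The joint law of `(X, Y)` in the yes case: `X ~ N(0, S)` and `Y = H X`. -/
def yesGaussian {n : ℕ} (S : Matrix (Fin n → Bool) (Fin n → Bool) ℝ) :
    Measure ((Fin n → Bool) ⊕ (Fin n → Bool) → ℝ) :=
  (multivariateGaussian 0 S).map fun x => Sum.elim x.ofLp (hadamardMatrix n *ᵥ x.ofLp)

/-- The joint law of `(X, Y)` in the no case: `X ~ N(0, S)` and `Y ~ N(0, H S H)`, independent. -/
def noGaussian {n : ℕ} (S : Matrix (Fin n → Bool) (Fin n → Bool) ℝ) :
    Measure ((Fin n → Bool) ⊕ (Fin n → Bool) → ℝ) :=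
  ((multivariateGaussian 0 S).prod
    (multivariateGaussian 0 (hadamardMatrix n * S * hadamardMatrix n))).map
      fun p => Sum.elim p.1.ofLp p.2.ofLp

/-- From the law `μ` of `(X, Y)` to the law of `(X, Y')`, where `Y'_i = Y_i ^ 2 - E[Y_i ^ 2]`. -/
def squareSecond {I : Type*} (μ : Measure (I ⊕ I → ℝ)) : Measure (I ⊕ I → ℝ) :=
  μ.map fun z => Sum.elim (fun i => z (Sum.inl i))
    (fun i => z (Sum.inr i) ^ 2 - ∫ w, w (Sum.inr i) ^ 2 ∂μ)

/-- The truncated yes distribution of `SQUAREDFORRELATION(S)` on `{±1}^{2N}`. -/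
def truncatedYes {n : ℕ} (S : Matrix (Fin n → Bool) (Fin n → Bool) ℝ) :
    Measure (SignCube ((Fin n → Bool) ⊕ (Fin n → Bool))) :=
  truncated (squareSecond (yesGaussian S))

/-- The truncated no distribution of `SQUAREDFORRELATION(S)` on `{±1}^{2N}`. -/
def truncatedNo {n : ℕ} (S : Matrix (Fin n → Bool) (Fin n → Bool) ℝ) :
    Measure (SignCube ((Fin n → Bool) ⊕ (Fin n → Bool))) :=
  truncated (squareSecond (noGaussian S))

end

/-! ## Gaussian integration by parts -/

lemma hasDerivAt_gaussianPDFReal (x : ℝ) :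
    HasDerivAt (gaussianPDFReal 0 1) (-(x * gaussianPDFReal 0 1 x)) x := by
  have h : HasDerivAt (fun y : ℝ => (√(2 * Real.pi * 1))⁻¹ * Real.exp (-(y - 0) ^ 2 / (2 * 1)))
      ((√(2 * Real.pi * 1))⁻¹ * (Real.exp (-(x - 0) ^ 2 / (2 * 1)) * (-x))) x := by
    refine HasDerivAt.const_mul _ (HasDerivAt.exp ?_)
    have := (((hasDerivAt_id x).sub_const 0).pow 2).neg.div_const (2 * 1)
    refine this.congr_deriv ?_
    simp
    ring
  convert h using 1
  · ext y; simp [gaussianPDFReal]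
  · simp [gaussianPDFReal]; ring

lemma integral_mul_gaussianReal_of_hasDerivAt {f f' : ℝ → ℝ} {B : ℝ}
    (hf : ∀ x, HasDerivAt f (f' x) x) (hB : ∀ x, |f x| ≤ B) (hB' : ∀ x, |f' x| ≤ B) :
    ∫ x, x * f x ∂(gaussianReal 0 1) = ∫ x, f' x ∂(gaussianReal 0 1) := by
  have hcont : Continuous f := continuous_iff_continuousAt.2 fun x => (hf x).continuousAt
  have hmeas : Measurable f' := by
    have : f' = deriv f := by ext x; exact (hf x).deriv.symm
    rw [this]; exact measurable_deriv f
  have hint : Integrable (gaussianPDFReal 0 1) := integrable_gaussianPDFReal 0 1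
  have hint' : Integrable fun x : ℝ => x * gaussianPDFReal 0 1 x := by
    have h := (memLp_id_gaussianReal (μ := 0) (v := 1) 1).integrable (by simp)
    rw [gaussianReal_of_var_ne_zero _ one_ne_zero] at h
    rw [integrable_withDensity_iff_integrable_smul₀' (by fun_prop)
      (Filter.Eventually.of_forall fun _ => gaussianPDF_lt_top)] at h
    simpa [toReal_gaussianPDF, mul_comm] using h
  have key := integral_mul_deriv_eq_deriv_mul_of_integrable (u := f) (u' := f')
    (v := gaussianPDFReal 0 1) (v' := fun x => -(x * gaussianPDFReal 0 1 x)) (fun x _ => hf x)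
    (fun x _ => hasDerivAt_gaussianPDFReal x)
    (hint'.neg.bdd_mul hcont.aestronglyMeasurable (Filter.Eventually.of_forall hB))
    (hint.bdd_mul hmeas.aestronglyMeasurable (Filter.Eventually.of_forall hB'))
    (hint.bdd_mul hcont.aestronglyMeasurable (Filter.Eventually.of_forall hB))
  rw [integral_gaussianReal_eq_integral_smul one_ne_zero,
    integral_gaussianReal_eq_integral_smul one_ne_zero]
  simp only [smul_eq_mul]
  rw [← neg_inj, ← integral_neg]
  convert key using 1
  · congr 1; ext x; ring
  · congr 2; ext x; ring

/-- The law of a vector of independent standard Gaussian variables. -/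
noncomputable abbrev stdGaussianPi (κ : Type*) [Fintype κ] : Measure (κ → ℝ) :=
  Measure.pi fun _ => gaussianReal 0 1

section Pi

variable {κ : Type*} [Fintype κ] [DecidableEq κ]

lemma measurePreserving_update {X : κ → Type*} [∀ k, MeasurableSpace (X k)]
    (μ : ∀ k, Measure (X k)) [∀ k, IsProbabilityMeasure (μ k)] (b : κ) :
    MeasurePreserving (fun p : (∀ k, X k) × X b => Function.update p.1 b p.2)
      ((Measure.pi μ).prod (μ b)) (Measure.pi μ) := by
  have hm : Measurable fun p : (∀ k, X k) × X b => Function.update p.1 b p.2 := by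
    refine measurable_pi_iff.2 fun k => ?_
    by_cases h : k = b
    · subst h; simpa using measurable_snd
    · simp only [Function.update_of_ne h]; fun_prop
  refine ⟨hm, (Measure.pi_eq fun s hs => ?_).symm⟩
  rw [Measure.map_apply hm (MeasurableSet.univ_pi hs)]
  have : (fun p : (∀ k, X k) × X b => Function.update p.1 b p.2) ⁻¹' (Set.univ.pi s) =
      (Set.univ.pi (Function.update s b Set.univ)) ×ˢ s b := by
    ext p
    simp only [Set.mem_preimage, Set.mem_univ_pi, Set.mem_prod]
    constructor
    · intro h
      refine ⟨fun k => ?_, by simpa using h b⟩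
      by_cases hk : k = b
      · subst hk; simp
      · simpa [hk] using h k
    · rintro ⟨h1, h2⟩ k
      by_cases hk : k = b
      · subst hk; simpa using h2
      · simpa [hk] using h1 k
  rw [this, Measure.prod_prod, Measure.pi_pi, ← Finset.mul_prod_erase _ _ (Finset.mem_univ b),
    ← Finset.mul_prod_erase (a := b) _ (fun k => μ k (s k)) (Finset.mem_univ b)]
  simp only [Function.update_self, measure_univ, one_mul]
  rw [mul_comm]
  congr 1
  refine Finset.prod_congr rfl fun k hk => ?_
  rw [Function.update_of_ne (Finset.ne_of_mem_erase hk)]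

omit [DecidableEq κ] in
lemma integrable_eval_stdGaussianPi (b : κ) :
    Integrable (fun g : κ → ℝ => g b) (stdGaussianPi κ) :=
  integrable_eval ((memLp_id_gaussianReal (μ := 0) (v := 1) 1).integrable (by simp))

omit [DecidableEq κ] in
lemma Integrable.of_measurable_of_abs_le {Ω : Type*} [MeasurableSpace Ω] {μ : Measure Ω}
    [IsFiniteMeasure μ] {f : Ω → ℝ} (hf : Measurable f) {B : ℝ} (hB : ∀ x, |f x| ≤ B) :
    Integrable f μ :=
  Integrable.of_bound hf.aestronglyMeasurable B (Filter.Eventually.of_forall hB)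

lemma integral_eval_mul_stdGaussianPi {f f' : (κ → ℝ) → ℝ} {B : ℝ} (b : κ)
    (hf : ∀ g x, HasDerivAt (fun y => f (Function.update g b y)) (f' (Function.update g b x)) x)
    (hm : Measurable f) (hm' : Measurable f') (hB : ∀ g, |f g| ≤ B) (hB' : ∀ g, |f' g| ≤ B) :
    ∫ g, g b * f g ∂(stdGaussianPi κ) = ∫ g, f' g ∂(stdGaussianPi κ) := by
  have hmp := measurePreserving_update (fun _ : κ => gaussianReal 0 1) b
  have h1 : Integrable (fun g : κ → ℝ => g b * f g) (stdGaussianPi κ) :=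
    (integrable_eval_stdGaussianPi b).mul_bdd hm.aestronglyMeasurable
      (Filter.Eventually.of_forall hB)
  have h2 : Integrable f' (stdGaussianPi κ) := Integrable.of_measurable_of_abs_le hm' hB'
  have e1 := integral_map (μ := (stdGaussianPi κ).prod (gaussianReal 0 1)) hmp.aemeasurable
    (f := fun g : κ → ℝ => g b * f g) (by rw [hmp.map_eq]; exact h1.aestronglyMeasurable)
  have e2 := integral_map (μ := (stdGaussianPi κ).prod (gaussianReal 0 1)) hmp.aemeasurable
    (f := f') (by rw [hmp.map_eq]; exact h2.aestronglyMeasurable)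
  rw [hmp.map_eq] at e1 e2
  have i1 := integral_prod _ (hmp.integrable_comp_of_integrable h1)
  have i2 := integral_prod _ (hmp.integrable_comp_of_integrable h2)
  simp only [Function.comp_def] at i1 i2
  rw [e1, e2, i1, i2]
  congr 1
  ext g
  simp only [Function.update_self]
  exact integral_mul_gaussianReal_of_hasDerivAt (hf g) (fun x => hB _) fun x => hB' _

end Pi

/-! ## Products of functions of one variable -/

section ProdFun

variable {κ : Type*} [Fintype κ] [DecidableEq κ]

/-- The function `z ↦ ∏ k, p k (z k)`. -/
def prodFun (p : κ → ℝ → ℝ) (z : κ → ℝ) : ℝ := ∏ k, p k (z k)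

/-- `q k` is the derivative of `p k`, and both are bounded by `B`, for all `k`. -/
structure BddDeriv (p q : κ → ℝ → ℝ) (B : ℝ) : Prop where
  hasDerivAt : ∀ k x, HasDerivAt (p k) (q k x) x
  abs_le : ∀ k x, |p k x| ≤ B
  abs_deriv_le : ∀ k x, |q k x| ≤ B

omit [Fintype κ] in
lemma BddDeriv.update {p q r : κ → ℝ → ℝ} {B : ℝ} (h : BddDeriv p q B) (h' : BddDeriv q r B)
    (a : κ) : BddDeriv (Function.update p a (q a)) (Function.update q a (r a)) B := by
  refine ⟨fun k x => ?_, fun k x => ?_, fun k x => ?_⟩ <;> by_cases hk : k = a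
  · subst hk; simpa using h'.hasDerivAt k x
  · simpa [hk] using h.hasDerivAt k x
  · subst hk; simpa using h'.abs_le k x
  · simpa [hk] using h.abs_le k x
  · subst hk; simpa using h'.abs_deriv_le k x
  · simpa [hk] using h.abs_deriv_le k x

omit [Fintype κ] [DecidableEq κ] in
lemma BddDeriv.measurable {p q : κ → ℝ → ℝ} {B : ℝ} (h : BddDeriv p q B) (k : κ) :
    Measurable (p k) :=
  (continuous_iff_continuousAt.2 fun x => (h.hasDerivAt k x).continuousAt).measurable

omit [Fintype κ] [DecidableEq κ] in
lemma BddDeriv.measurable_deriv {p q : κ → ℝ → ℝ} {B : ℝ} (h : BddDeriv p q B) (k : κ) :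
    Measurable (q k) := by
  have : q k = deriv (p k) := by ext x; exact (h.hasDerivAt k x).deriv.symm
  rw [this]; exact _root_.measurable_deriv (p k)

omit [DecidableEq κ] in
lemma measurable_prodFun {p : κ → ℝ → ℝ} (h : ∀ k, Measurable (p k)) : Measurable (prodFun p) :=
  Finset.measurable_prod _ fun k _ => (h k).comp (measurable_pi_apply k)

omit [DecidableEq κ] in
lemma abs_prodFun_le {p : κ → ℝ → ℝ} {B : ℝ} (h : ∀ k x, |p k x| ≤ B) (z : κ → ℝ) :
    |prodFun p z| ≤ B ^ Fintype.card κ := by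
  rw [prodFun, Finset.abs_prod]
  exact (Finset.prod_le_prod (fun _ _ => abs_nonneg _) fun k _ => h k _).trans (by simp)

lemma prodFun_update (p : κ → ℝ → ℝ) (a : κ) (q : ℝ → ℝ) (z : κ → ℝ) :
    prodFun (Function.update p a q) z = q (z a) * ∏ k ∈ Finset.univ.erase a, p k (z k) := by
  rw [prodFun, ← Finset.mul_prod_erase _ _ (Finset.mem_univ a)]
  simp only [Function.update_self]
  congr 1
  refine Finset.prod_congr rfl fun k hk => ?_
  rw [Function.update_of_ne (Finset.ne_of_mem_erase hk)]

lemma measurable_update_deriv {p q : κ → ℝ → ℝ} {B : ℝ} (h : BddDeriv p q B) (a : κ) :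
    Measurable (prodFun (Function.update p a (q a))) := by
  refine measurable_prodFun fun k => ?_
  by_cases hk : k = a
  · subst hk; simpa using h.measurable_deriv k
  · simpa [hk] using h.measurable k

lemma abs_update_deriv_le {p q : κ → ℝ → ℝ} {B : ℝ} (h : BddDeriv p q B) (a : κ) (z : κ → ℝ) :
    |prodFun (Function.update p a (q a)) z| ≤ B ^ Fintype.card κ := by
  refine abs_prodFun_le (fun k x => ?_) z
  by_cases hk : k = a
  · subst hk; simpa using h.abs_deriv_le k x
  · simpa [hk] using h.abs_le k x

lemma hasDerivAt_prodFun {p q : κ → ℝ → ℝ} {B : ℝ} (h : BddDeriv p q B) {z : ℝ → κ → ℝ}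
    {z' : κ → ℝ} {t : ℝ} (hz : ∀ k, HasDerivAt (fun s => z s k) (z' k) t) :
    HasDerivAt (fun s => prodFun p (z s))
      (∑ a, z' a * prodFun (Function.update p a (q a)) (z t)) t := by
  have := HasDerivAt.fun_finsetProd (u := (Finset.univ : Finset κ)) (x := t)
    (f := fun k s => p k (z s k)) (f' := fun k => q k (z t k) * z' k)
    fun k _ => (h.hasDerivAt k (z t k)).comp t (hz k)
  refine this.congr_deriv ?_
  refine Finset.sum_congr rfl fun a _ => ?_
  rw [prodFun_update, smul_eq_mul]; ring

/-- Gaussian integration by parts for a product function of a linear image. -/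
lemma integral_eval_mul_prodFun_mulVec {τ : Type*} [Fintype τ] [DecidableEq τ]
    {p q : κ → ℝ → ℝ} {B : ℝ} (h : BddDeriv p q B) (M : Matrix κ τ ℝ) (b : τ) :
    ∫ g, g b * prodFun p (M *ᵥ g) ∂(stdGaussianPi τ) =
      ∑ c, M c b * ∫ g, prodFun (Function.update p c (q c)) (M *ᵥ g) ∂(stdGaussianPi τ) := by
  have hM : Measurable fun g : τ → ℝ => M *ᵥ g := by
    have : Continuous fun g : τ → ℝ => M *ᵥ g := by fun_prop
    exact this.measurable
  have hi : ∀ c, Integrable (fun g : τ → ℝ => prodFun (Function.update p c (q c)) (M *ᵥ g))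
      (stdGaussianPi τ) := fun c =>
    Integrable.of_measurable_of_abs_le ((measurable_update_deriv h c).comp hM)
      fun g => abs_update_deriv_le h c _
  simp_rw [← integral_const_mul]
  rw [← integral_finsetSum _ fun c _ => (hi c).const_mul _]
  have hb : ∀ g, |∑ c, M c b * prodFun (Function.update p c (q c)) (M *ᵥ g)| ≤
      ∑ c, |M c b| * B ^ Fintype.card κ := fun g => by
    refine (Finset.abs_sum_le_sum_abs _ _).trans (Finset.sum_le_sum fun c _ => ?_)
    rw [abs_mul]
    exact mul_le_mul_of_nonneg_left (abs_update_deriv_le h c _) (abs_nonneg _)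
  refine integral_eval_mul_stdGaussianPi
    (B := max (B ^ Fintype.card κ) (∑ c, |M c b| * B ^ Fintype.card κ)) b
    (fun g x => ?_) ((measurable_prodFun h.measurable).comp hM)
    (Finset.measurable_sum _ fun c _ => ((measurable_update_deriv h c).comp hM).const_mul _)
    (fun g => (abs_prodFun_le h.abs_le _).trans (le_max_left _ _))
    fun g => (hb g).trans (le_max_right _ _)
  refine hasDerivAt_prodFun h fun k => ?_
  simp only [mulVec, dotProduct]
  have := HasDerivAt.fun_sum (u := (Finset.univ : Finset τ)) (x := x)
    (A := fun c y => M k c * Function.update g b y c)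
    (A' := fun c => M k c * (if c = b then 1 else 0)) fun c _ => by
      refine HasDerivAt.const_mul _ ?_
      by_cases hc : c = b
      · subst hc; simpa using hasDerivAt_id' x
      · simpa [hc] using hasDerivAt_const x (g c)
  simpa using this

/-- Differentiating a Gaussian expectation along a path of linear maps. -/
lemma hasDerivAt_integral_prodFun_mulVec {τ : Type*} [Fintype τ] [DecidableEq τ]
    {p q r : κ → ℝ → ℝ} {B : ℝ} (h : BddDeriv p q B) (h' : BddDeriv q r B)
    {M M' : ℝ → Matrix κ τ ℝ} {D : ℝ} (hM : ∀ t a b, HasDerivAt (fun s => M s a b) (M' t a b) t)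
    (hD : ∀ t a b, |M' t a b| ≤ D) (t : ℝ) :
    HasDerivAt (fun s => ∫ g, prodFun p (M s *ᵥ g) ∂(stdGaussianPi τ))
      (∑ a, ∑ c, (M' t * (M t)ᵀ) a c * ∫ g, prodFun (Function.update (Function.update p a (q a)) c
        ((Function.update q a (r a)) c)) (M t *ᵥ g) ∂(stdGaussianPi τ)) t := by
  have hmM : ∀ M : Matrix κ τ ℝ, Measurable fun g : τ → ℝ => M *ᵥ g := fun M => by
    have : Continuous fun g : τ → ℝ => M *ᵥ g := by fun_prop
    exact this.measurable
  have hq : ∀ a, Measurable (prodFun (Function.update p a (q a))) := measurable_update_deriv h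
  have hi : ∀ b, Integrable (fun g : τ → ℝ => g b) (stdGaussianPi τ) :=
    integrable_eval_stdGaussianPi
  have hib : ∀ a b, Integrable
      (fun g : τ → ℝ => g b * prodFun (Function.update p a (q a)) (M t *ᵥ g))
      (stdGaussianPi τ) := fun a b =>
    (hi b).mul_bdd ((hq a).comp (hmM _)).aestronglyMeasurable
      (Filter.Eventually.of_forall fun g => abs_update_deriv_le h a _)
  have key := hasDerivAt_integral_of_dominated_loc_of_deriv_le (μ := stdGaussianPi τ)
    (F := fun s g => prodFun p (M s *ᵥ g))
    (F' := fun s g => ∑ a, (M' s *ᵥ g) a * prodFun (Function.update p a (q a)) (M s *ᵥ g))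
    (x₀ := t) (s := Set.univ)
    (bound := fun g => ∑ _a : κ, (∑ b, D * |g b|) * B ^ Fintype.card κ) Filter.univ_mem
    (Filter.Eventually.of_forall fun s =>
      ((measurable_prodFun h.measurable).comp (hmM _)).aestronglyMeasurable)
    (Integrable.of_measurable_of_abs_le ((measurable_prodFun h.measurable).comp (hmM _))
      fun g => abs_prodFun_le h.abs_le _)
    (Finset.measurable_sum _ fun a _ => ((measurable_pi_apply a).comp (hmM _)).mul
      ((hq a).comp (hmM _))).aestronglyMeasurable
    (Filter.Eventually.of_forall fun g s _ => by
      rw [Real.norm_eq_abs]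
      refine (Finset.abs_sum_le_sum_abs _ _).trans (Finset.sum_le_sum fun a _ => ?_)
      rw [abs_mul]
      refine mul_le_mul ?_ (abs_update_deriv_le h a _) (abs_nonneg _) ?_
      · simp only [mulVec, dotProduct]
        refine (Finset.abs_sum_le_sum_abs _ _).trans (Finset.sum_le_sum fun b _ => ?_)
        rw [abs_mul]
        exact mul_le_mul_of_nonneg_right (hD s a b) (abs_nonneg _)
      · exact Finset.sum_nonneg fun b _ =>
          mul_nonneg ((abs_nonneg _).trans (hD s a b)) (abs_nonneg _))
    (integrable_finsetSum _ fun a _ => (integrable_finsetSum _ fun b _ =>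
      (hi b).abs.const_mul D).mul_const _)
    (Filter.Eventually.of_forall fun g s _ => hasDerivAt_prodFun h fun k => by
      simp only [mulVec, dotProduct]
      exact HasDerivAt.fun_sum fun b _ => (hM s k b).mul_const _)
  refine key.2.congr_deriv ?_
  have e : ∀ g : τ → ℝ, ∑ a, (M' t *ᵥ g) a * prodFun (Function.update p a (q a)) (M t *ᵥ g) =
      ∑ a, ∑ b, M' t a b * (g b * prodFun (Function.update p a (q a)) (M t *ᵥ g)) := fun g => by
    refine Finset.sum_congr rfl fun a _ => ?_
    simp only [mulVec, dotProduct, Finset.sum_mul, mul_assoc]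
  rw [integral_congr_ae (Filter.Eventually.of_forall e)]
  refine (integral_finsetSum Finset.univ (f := fun a (g : τ → ℝ) => ∑ b, M' t a b *
    (g b * prodFun (Function.update p a (q a)) (M t *ᵥ g))) fun a _ =>
      integrable_finsetSum _ fun b _ => (hib a b).const_mul _).trans
    (Finset.sum_congr rfl fun a _ => ?_)
  refine (integral_finsetSum Finset.univ (f := fun b (g : τ → ℝ) => M' t a b *
    (g b * prodFun (Function.update p a (q a)) (M t *ᵥ g)))
      fun b _ => (hib a b).const_mul _).trans ?_
  simp_rw [integral_const_mul, integral_eval_mul_prodFun_mulVec (h.update h' a), mul_apply,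
    transpose_apply, Finset.sum_mul, Finset.mul_sum]
  rw [Finset.sum_comm]
  simp_rw [mul_assoc]

end ProdFun

/-! ## Multilinear extensions and random restrictions -/

section Restriction

variable {κ : Type*} [Fintype κ] [DecidableEq κ]

/-- The derivative at `u`, in the directions in `T`, of the multilinear extension of `F`. -/
noncomputable def biasedCoeff (F : SignCube κ → ℝ) (T : Finset κ) (u : κ → ℝ) : ℝ :=
  ∑ w : SignCube κ, F w * ∏ k, if k ∈ T then ((w k : ℤ) : ℝ) / 2 else (1 + ((w k : ℤ) : ℝ) * u k) / 2

lemma biasedCoeff_congr (F : SignCube κ → ℝ) {T : Finset κ} {u v : κ → ℝ}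
    (h : ∀ k, k ∉ T → u k = v k) : biasedCoeff F T u = biasedCoeff F T v := by
  refine Finset.sum_congr rfl fun w _ => ?_
  congr 1
  refine Finset.prod_congr rfl fun k _ => ?_
  split_ifs with hk
  · rfl
  · rw [h k hk]

lemma continuous_biasedCoeff (F : SignCube κ → ℝ) (T : Finset κ) :
    Continuous (biasedCoeff F T) := by
  unfold biasedCoeff
  refine continuous_finsetSum _ fun w _ => continuous_const.mul ?_
  refine continuous_finsetProd _ fun k _ => ?_
  split_ifs <;> fun_prop

/-- The weight of a value at the coordinate `k` of a random restriction that leaves `k` free with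
probability `α k` and whose fixed part has mean `u k`. -/
noncomputable def restrictionWeight (α u : κ → ℝ) (k : κ) : Option ℤˣ → ℝ
  | none => α k
  | some s => (1 - α k + ((s : ℤ) : ℝ) * u k) / 2

omit [Fintype κ] [DecidableEq κ] in
lemma restrictionWeight_nonneg {α u : κ → ℝ} (hα : ∀ k, 0 ≤ α k) (hu : ∀ k, |u k| ≤ 1 - α k)
    (k : κ) (r : Option ℤˣ) : 0 ≤ restrictionWeight α u k r := by
  have h1 := abs_le.1 (hu k)
  cases r with
  | none => exact hα k
  | some s =>
    rcases Int.units_eq_one_or s with rfl | rfl <;> simp [restrictionWeight] <;> linarith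

omit [DecidableEq κ] in
lemma sum_prod_eq_prod_sum {β : Type*} [Fintype β] [DecidableEq κ] (f : κ → β → ℝ) :
    ∑ x : κ → β, ∏ k, f k (x k) = ∏ k, ∑ b, f k b := by
  rw [Finset.prod_univ_sum, Fintype.piFinset_univ]

lemma sum_restrictionWeight (α u : κ → ℝ) :
    ∑ ρ : κ → Option ℤˣ, ∏ k, restrictionWeight α u k (ρ k) = 1 := by
  rw [sum_prod_eq_prod_sum]
  refine Finset.prod_eq_one fun k _ => ?_
  simp [Fintype.sum_option, UnitsInt.univ, restrictionWeight]
  ring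

lemma sum_restrictionWeight_mul_cubeFourierCoeff (F : SignCube κ → ℝ) (T : Finset κ)
    (α u : κ → ℝ) :
    ∑ ρ : κ → Option ℤˣ, (∏ k, restrictionWeight α u k (ρ k)) *
      cubeFourierCoeff (restrictBy F ρ) T = (∏ k ∈ T, α k) * biasedCoeff F T u := by
  have h1 : ∀ (ρ : κ → Option ℤˣ), (∏ k, restrictionWeight α u k (ρ k)) *
      cubeFourierCoeff (restrictBy F ρ) T = ∑ w : SignCube κ, F w * ∑ z : SignCube κ, ∏ k,
        if (ρ k).getD (z k) = w k then restrictionWeight α u k (ρ k) *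
          (if k ∈ T then ((z k : ℤ) : ℝ) else 1) / 2 else 0 := by
    intro ρ
    simp_rw [Finset.mul_sum]
    rw [Finset.sum_comm, cubeFourierCoeff, Finset.sum_div, Finset.mul_sum]
    refine Finset.sum_congr rfl fun z _ => ?_
    rw [Finset.sum_eq_single (fun k => (ρ k).getD (z k))]
    · simp only [if_true, restrictBy, Finset.prod_div_distrib, Finset.prod_mul_distrib]
      simp only [Finset.prod_ite_mem, Finset.univ_inter, Finset.prod_const, Finset.card_univ]
      ring
    · intro w _ hw
      obtain ⟨k, hk⟩ := Function.ne_iff.1 hw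
      rw [Finset.prod_eq_zero (Finset.mem_univ k) (if_neg (Ne.symm hk)), mul_zero]
    · simp
  simp_rw [h1]
  rw [Finset.sum_comm, biasedCoeff, Finset.mul_sum]
  refine Finset.sum_congr rfl fun w _ => ?_
  rw [← Finset.mul_sum, mul_left_comm]
  congr 1
  have h2 : ∀ ρ : κ → Option ℤˣ, ∑ z : SignCube κ, (∏ k,
        if (ρ k).getD (z k) = w k then restrictionWeight α u k (ρ k) *
          (if k ∈ T then ((z k : ℤ) : ℝ) else 1) / 2 else 0) =
      ∏ k, ∑ s : ℤˣ, if (ρ k).getD s = w k then restrictionWeight α u k (ρ k) *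
          (if k ∈ T then ((s : ℤ) : ℝ) else 1) / 2 else 0 := fun ρ =>
    sum_prod_eq_prod_sum (fun k s => if (ρ k).getD s = w k then restrictionWeight α u k (ρ k) *
          (if k ∈ T then ((s : ℤ) : ℝ) else 1) / 2 else 0)
  simp_rw [h2]
  rw [sum_prod_eq_prod_sum (fun k r => ∑ s : ℤˣ, if Option.getD r s = w k then
    restrictionWeight α u k r * (if k ∈ T then ((s : ℤ) : ℝ) else 1) / 2 else 0)]
  have h3 : ∏ k ∈ T, α k = ∏ k, if k ∈ T then α k else 1 := by
    rw [Finset.prod_ite_mem, Finset.univ_inter]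
  rw [h3, ← Finset.prod_mul_distrib]
  refine Finset.prod_congr rfl fun k _ => ?_
  have hne : ¬ ((-1 : ℤˣ) = 1) := by decide
  have hne' : ¬ ((1 : ℤˣ) = -1) := by decide
  rcases Int.units_eq_one_or (w k) with h | h <;> by_cases hk : k ∈ T <;>
    simp [Fintype.sum_option, UnitsInt.univ, restrictionWeight, h, hk, hne, hne'] <;> ring

lemma sum_abs_biasedCoeff_le {F : SignCube κ → ℝ} {l : ℝ}
    (hl : ∀ ρ : κ → Option ℤˣ, levelMass 2 (restrictBy F ρ) ≤ l) {α u : κ → ℝ}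
    (hα : ∀ k, 0 ≤ α k) (hu : ∀ k, |u k| ≤ 1 - α k) :
    ∑ T ∈ (Finset.univ : Finset κ).powersetCard 2, (∏ k ∈ T, α k) * |biasedCoeff F T u| ≤ l := by
  have hw : ∀ ρ : κ → Option ℤˣ, 0 ≤ ∏ k, restrictionWeight α u k (ρ k) := fun ρ =>
    Finset.prod_nonneg fun k _ => restrictionWeight_nonneg hα hu k _
  calc ∑ T ∈ (Finset.univ : Finset κ).powersetCard 2, (∏ k ∈ T, α k) * |biasedCoeff F T u|
      ≤ ∑ T ∈ (Finset.univ : Finset κ).powersetCard 2, ∑ ρ : κ → Option ℤˣ,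
        (∏ k, restrictionWeight α u k (ρ k)) * |cubeFourierCoeff (restrictBy F ρ) T| := by
        refine Finset.sum_le_sum fun T _ => ?_
        rw [← abs_of_nonneg (Finset.prod_nonneg fun k (_ : k ∈ T) => hα k), ← abs_mul,
          ← sum_restrictionWeight_mul_cubeFourierCoeff]
        refine (Finset.abs_sum_le_sum_abs _ _).trans_eq (Finset.sum_congr rfl fun ρ _ => ?_)
        rw [abs_mul, abs_of_nonneg (hw ρ)]
    _ = ∑ ρ : κ → Option ℤˣ, (∏ k, restrictionWeight α u k (ρ k)) *
        levelMass 2 (restrictBy F ρ) := by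
        rw [Finset.sum_comm]
        simp_rw [levelMass, Finset.mul_sum]
    _ ≤ ∑ ρ : κ → Option ℤˣ, (∏ k, restrictionWeight α u k (ρ k)) * l :=
        Finset.sum_le_sum fun ρ _ => mul_le_mul_of_nonneg_left (hl ρ) (hw ρ)
    _ = l := by rw [← Finset.sum_mul, sum_restrictionWeight, one_mul]

lemma sum_abs_biasedCoeff_le_of_abs_le_half {F : SignCube κ → ℝ} {l : ℝ}
    (hl : ∀ ρ : κ → Option ℤˣ, levelMass 2 (restrictBy F ρ) ≤ l) {u : κ → ℝ}
    (hu : ∀ k, |u k| ≤ 1 / 2) :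
    ∑ T ∈ (Finset.univ : Finset κ).powersetCard 2, |biasedCoeff F T u| ≤ 4 * l := by
  have h := sum_abs_biasedCoeff_le hl (α := fun _ => 1 / 2) (u := u) (fun _ => by norm_num)
    fun k => (hu k).trans (by norm_num)
  have h' : ∑ T ∈ (Finset.univ : Finset κ).powersetCard 2, (∏ _k ∈ T, (1 / 2 : ℝ)) *
      |biasedCoeff F T u| =
      (1 / 4) * ∑ T ∈ (Finset.univ : Finset κ).powersetCard 2, |biasedCoeff F T u| := by
    rw [Finset.mul_sum]
    refine Finset.sum_congr rfl fun T hT => ?_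
    rw [Finset.prod_const, (Finset.mem_powersetCard.1 hT).2]
    norm_num
  linarith

lemma abs_biasedCoeff_le {F : SignCube κ → ℝ} {l : ℝ}
    (hl : ∀ ρ : κ → Option ℤˣ, levelMass 2 (restrictBy F ρ) ≤ l) {u : κ → ℝ}
    (hu : ∀ k, |u k| ≤ 1) {T : Finset κ} (hT : T.card = 2) : |biasedCoeff F T u| ≤ l := by
  have h := sum_abs_biasedCoeff_le hl (α := fun k => if k ∈ T then 1 else 0)
    (u := fun k => if k ∈ T then 0 else u k) (fun k => by split_ifs <;> norm_num)
    fun k => by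
      split_ifs
      · norm_num
      · simpa using hu k
  refine le_trans ?_ h
  have hmem : T ∈ (Finset.univ : Finset κ).powersetCard 2 :=
    Finset.mem_powersetCard.2 ⟨Finset.subset_univ _, hT⟩
  refine le_trans (le_of_eq ?_) (Finset.single_le_sum (f := fun T' : Finset κ =>
    (∏ k ∈ T', if k ∈ T then (1 : ℝ) else 0) *
      |biasedCoeff F T' fun k => if k ∈ T then 0 else u k|) (fun T' _ => mul_nonneg
        (Finset.prod_nonneg fun k _ => by split_ifs <;> norm_num) (abs_nonneg _)) hmem)
  rw [Finset.prod_congr rfl fun k hk => if_pos hk, Finset.prod_const_one, one_mul]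
  congr 1
  exact biasedCoeff_congr F fun k hk => (if_neg hk).symm

end Restriction

lemma sum_abs_biasedCoeff_pair_le {I : Type*} [Fintype I] [DecidableEq I]
    {F : SignCube (I ⊕ I) → ℝ} {l : ℝ}
    (hl : ∀ ρ : I ⊕ I → Option ℤˣ, levelMass 2 (restrictBy F ρ) ≤ l) {u : I ⊕ I → ℝ}
    (hu : ∀ k, |u k| ≤ 1 / 2) :
    ∑ i : I, ∑ j : I, |biasedCoeff F {Sum.inl i, Sum.inr j} u| ≤ 4 * l := by
  refine le_trans ?_ (sum_abs_biasedCoeff_le_of_abs_le_half hl hu)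
  rw [← Finset.sum_product', Finset.univ_product_univ]
  let e : I × I → Finset (I ⊕ I) := fun p => {Sum.inl p.1, Sum.inr p.2}
  have he : Function.Injective e := by
    rintro ⟨i, j⟩ ⟨i', j'⟩ h
    have h1 : Sum.inl i ∈ e (i', j') := h ▸ by simp [e]
    have h2 : Sum.inr j ∈ e (i', j') := h ▸ by simp [e]
    simp only [e, Finset.mem_insert, Finset.mem_singleton, reduceCtorEq, or_false, false_or,
      Sum.inl.injEq, Sum.inr.injEq] at h1 h2
    rw [h1, h2]
  rw [← Finset.sum_image (f := fun T => |biasedCoeff F T u|) (g := e) (fun a _ b _ h => he h)]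
  refine Finset.sum_le_sum_of_subset_of_nonneg (fun T hT => ?_) fun _ _ _ => abs_nonneg _
  obtain ⟨p, -, rfl⟩ := Finset.mem_image.1 hT
  exact Finset.mem_powersetCard.2 ⟨Finset.subset_univ _, Finset.card_pair (by simp)⟩

/-! ## Smooth approximations of the truncation -/

/-- `g` is a `C²` approximation, with derivatives `s` and `s'`, of the truncation to `[-1, 1]`. -/
structure SmoothTrnc (g s s' : ℝ → ℝ) : Prop where
  hasDerivAt : ∀ x, HasDerivAt g (s x) x
  hasDerivAt' : ∀ x, HasDerivAt s (s' x) x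
  abs_le_one : ∀ x, |g x| ≤ 1
  abs_le_abs : ∀ x, |g x| ≤ |x|
  deriv_nonneg : ∀ x, 0 ≤ s x
  deriv_le : ∀ x, s x ≤ 1
  deriv_eq_zero : ∀ x, 1 ≤ |x| → s x = 0
  exists_bound : ∃ B, ∀ x, |s' x| ≤ B
  deriv2_eq_zero : ∀ x, 1 ≤ |x| → s' x = 0

lemma exists_smoothTrnc {δ : ℝ} (hδ : 0 < δ) (hδ' : δ < 1) :
    ∃ g s s' : ℝ → ℝ, SmoothTrnc g s s' ∧ ∀ x, |g x - trnc x| ≤ δ := by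
  let f : ContDiffBump (0 : ℝ) := ⟨1 - δ, 1, by linarith, by linarith⟩
  have hcont : Continuous f := f.continuous
  have hg : ∀ x, HasDerivAt (fun x => ∫ t in (0 : ℝ)..x, f t) (f x) x := fun x =>
    intervalIntegral.integral_hasDerivAt_right (hcont.intervalIntegrable _ _)
      (hcont.stronglyMeasurableAtFilter _ _) hcont.continuousAt
  have hdiff : ContDiff ℝ 1 f := f.contDiff
  have hzero : ∀ x, 1 ≤ |x| → f x = 0 := fun x hx =>
    f.zero_of_le_dist (by simpa [Real.dist_eq, f] using hx)
  have hone : ∀ x, |x| ≤ 1 - δ → f x = 1 := fun x hx =>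
    f.one_of_mem_closedBall (by simpa [Metric.mem_closedBall, Real.dist_eq, f] using hx)
  set g : ℝ → ℝ := fun x => ∫ t in (0 : ℝ)..x, f t with hgdef
  have hgd : Differentiable ℝ g := fun x => (hg x).differentiableAt
  have hmono : Monotone g := monotone_of_deriv_nonneg hgd fun x => by
    rw [(hg x).deriv]; exact f.nonneg
  have hmono' : Monotone fun x => x - g x := by
    refine monotone_of_deriv_nonneg (differentiable_id.sub hgd) fun x => ?_
    rw [((hasDerivAt_id' x).fun_sub (hg x)).deriv]
    exact sub_nonneg.2 f.le_one
  have hg0 : g 0 = 0 := by simp [hgdef]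
  have hid : ∀ x, |x| ≤ 1 - δ → g x = x := fun x hx => by
    have : g x = ∫ t in (0 : ℝ)..x, (1 : ℝ) := by
      refine intervalIntegral.integral_congr fun t ht => hone t ?_
      have h1 := abs_le.1 hx
      rcases le_total 0 x with h | h
      · rw [Set.uIcc_of_le h] at ht
        exact abs_le.2 ⟨by linarith [ht.1], by linarith [ht.2]⟩
      · rw [Set.uIcc_of_ge h] at ht
        exact abs_le.2 ⟨by linarith [ht.1], by linarith [ht.2]⟩
    simpa using this
  have hconst : ∀ x, 1 ≤ x → g x = g 1 := fun x hx => by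
    have := intervalIntegral.integral_interval_sub_left (hcont.intervalIntegrable 0 x)
      (hcont.intervalIntegrable (μ := volume) 0 1)
    have h0 : ∫ t in (1 : ℝ)..x, f t = ∫ t in (1 : ℝ)..x, (0 : ℝ) := by
      refine intervalIntegral.integral_congr fun t ht => hzero t ?_
      rw [Set.uIcc_of_le hx] at ht
      exact ht.1.trans (le_abs_self t)
    rw [h0, intervalIntegral.integral_zero] at this
    exact sub_eq_zero.1 this
  have hconst' : ∀ x, x ≤ -1 → g x = g (-1) := fun x hx => by
    have := intervalIntegral.integral_interval_sub_left (hcont.intervalIntegrable 0 x)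
      (hcont.intervalIntegrable (μ := volume) 0 (-1))
    have h0 : ∫ t in (-1 : ℝ)..x, f t = ∫ t in (-1 : ℝ)..x, (0 : ℝ) := by
      refine intervalIntegral.integral_congr fun t ht => hzero t ?_
      rw [Set.uIcc_of_ge hx] at ht
      have := neg_le_abs t
      linarith [ht.2]
    rw [h0, intervalIntegral.integral_zero] at this
    exact sub_eq_zero.1 this
  have hp : ∀ x, 0 ≤ x → 0 ≤ g x ∧ g x ≤ x := fun x hx => by
    have h1 := hmono hx
    have h2 := hmono' hx
    simp only [hg0] at h1 h2
    exact ⟨h1, by linarith⟩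
  have hn : ∀ x, x ≤ 0 → x ≤ g x ∧ g x ≤ 0 := fun x hx => by
    have h1 := hmono hx
    have h2 := hmono' hx
    simp only [hg0] at h1 h2
    exact ⟨by linarith, h1⟩
  have hup : ∀ x, g x ≤ 1 := fun x => by
    rcases le_total x 1 with h | h
    · exact (hmono h).trans (hp 1 zero_le_one).2
    · rw [hconst x h]; exact (hp 1 zero_le_one).2
  have hlow : ∀ x, -1 ≤ g x := fun x => by
    rcases le_total (-1) x with h | h
    · exact (hn (-1) (by norm_num)).1.trans (hmono h)
    · rw [hconst' x h]; exact (hn (-1) (by norm_num)).1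
  have hd2 : ∀ x, 1 ≤ |x| → deriv f x = 0 := fun x hx => by
    have hmin : IsLocalMin f x := Filter.Eventually.of_forall fun y => by
      rw [hzero x hx]; exact f.nonneg
    exact hmin.deriv_eq_zero
  refine ⟨g, f, deriv f, ⟨hg, fun x => (hdiff.differentiable one_ne_zero x).hasDerivAt,
    fun x => abs_le.2 ⟨hlow x, hup x⟩, fun x => ?_, fun x => f.nonneg, fun x => f.le_one, hzero,
    ?_, hd2⟩, fun x => ?_⟩
  · rcases le_total 0 x with h | h
    · rw [abs_of_nonneg h, abs_of_nonneg (hp x h).1]; exact (hp x h).2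
    · rw [abs_of_nonpos h, abs_of_nonpos (hn x h).2]; linarith [(hn x h).1]
  · obtain ⟨B, hB⟩ := (isCompact_Icc (a := (-1 : ℝ)) (b := 1)).exists_bound_of_continuousOn
      (hdiff.continuous_deriv le_rfl).continuousOn
    refine ⟨B, fun x => ?_⟩
    rcases le_total |x| 1 with h | h
    · exact hB x (abs_le.1 h)
    · rw [hd2 x h, abs_zero]
      exact (norm_nonneg _).trans (hB 0 (by simp))
  · have e1 : g (1 - δ) = 1 - δ := hid _ (by rw [abs_of_nonneg]; linarith)
    have e2 : g (-(1 - δ)) = -(1 - δ) := hid _ (by rw [abs_neg, abs_of_nonneg]; linarith)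
    rcases le_total |x| (1 - δ) with h | h
    · have h1 := abs_le.1 h
      have : trnc x = x := by
        rw [trnc, max_eq_right (by linarith), min_eq_right (by linarith)]
      rw [hid x h, this, sub_self, abs_zero]; exact hδ.le
    · rcases le_abs.1 h with h | h
      · have h1 := hmono h
        rw [e1] at h1
        have h2 : 1 - δ ≤ trnc x :=
          le_min (by linarith) (h.trans (le_max_right _ _))
        have h3 := (trnc_mem x).2
        have h4 := hup x
        exact abs_le.2 ⟨by linarith, by linarith⟩
      · have h1 := hmono (le_neg_of_le_neg h)
        rw [e2] at h1
        have h2 : trnc x ≤ -(1 - δ) :=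
          (min_le_right _ _).trans (max_le (by linarith) (by linarith))
        have h3 := (trnc_mem x).1
        have h4 := hlow x
        exact abs_le.2 ⟨by linarith, by linarith⟩

/-! ## The laws in terms of independent standard Gaussian variables -/

lemma signLaw_singleton (a : ℝ) (s : ℤˣ) :
    signLaw a {s} = ENNReal.ofReal ((1 + ((s : ℤ) : ℝ) * trnc a) / 2) := by
  have hne : ¬ ((-1 : ℤˣ) = 1) := by decide
  have hne' : ¬ ((1 : ℤˣ) = -1) := by decide
  rcases Int.units_eq_one_or s with rfl | rfl <;>
    simp [signLaw, hne, hne', sub_eq_add_neg]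

lemma one_add_sign_mul_nonneg (s : ℤˣ) {a : ℝ} (ha : |a| ≤ 1) :
    0 ≤ (1 + ((s : ℤ) : ℝ) * a) / 2 := by
  have h := abs_le.1 ha
  rcases Int.units_eq_one_or s with rfl | rfl <;> simp <;> linarith

lemma integral_truncated {κ : Type*} [Fintype κ] [DecidableEq κ] (μ : Measure (κ → ℝ))
    [IsProbabilityMeasure μ] (F : SignCube κ → ℝ) :
    ∫ w, F w ∂(truncated μ) = ∫ z, biasedCoeff F ∅ (fun k => trnc (z k)) ∂μ := by
  have habs : ∀ a, |trnc a| ≤ 1 := fun a => abs_le.2 (trnc_mem a)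
  have : IsProbabilityMeasure (truncated μ) :=
    isProbabilityMeasure_bind measurable_roundLaw.aemeasurable
      (Filter.Eventually.of_forall fun z => inferInstance)
  have hm : ∀ w : SignCube κ, Measurable fun z : κ → ℝ =>
      ∏ k, (1 + ((w k : ℤ) : ℝ) * trnc (z k)) / 2 := fun w => by
    have := measurable_trnc
    fun_prop
  have hnn : ∀ (w : SignCube κ) (z : κ → ℝ),
      0 ≤ ∏ k, (1 + ((w k : ℤ) : ℝ) * trnc (z k)) / 2 := fun w z =>
    Finset.prod_nonneg fun k _ => one_add_sign_mul_nonneg _ (habs _)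
  have hle : ∀ (w : SignCube κ) (z : κ → ℝ),
      |∏ k, (1 + ((w k : ℤ) : ℝ) * trnc (z k)) / 2| ≤ 1 := fun w z => by
    rw [abs_of_nonneg (hnn w z)]
    refine Finset.prod_le_one (fun k _ => one_add_sign_mul_nonneg _ (habs _)) fun k _ => ?_
    have h := trnc_mem (z k)
    rcases Int.units_eq_one_or (w k) with h' | h' <;> simp [h'] <;> linarith
  have hint : ∀ w : SignCube κ, Integrable (fun z : κ → ℝ =>
      ∏ k, (1 + ((w k : ℤ) : ℝ) * trnc (z k)) / 2) μ := fun w =>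
    Integrable.of_measurable_of_abs_le (hm w) (hle w)
  have hw : ∀ w : SignCube κ, (truncated μ).real {w} =
      ∫ z, ∏ k, (1 + ((w k : ℤ) : ℝ) * trnc (z k)) / 2 ∂μ := fun w => by
    rw [Measure.real, truncated, Measure.bind_apply (measurableSet_singleton w)
      measurable_roundLaw.aemeasurable, integral_eq_lintegral_of_nonneg_ae
      (Filter.Eventually.of_forall (hnn w)) (hm w).aestronglyMeasurable]
    congr 1
    refine lintegral_congr fun z => ?_
    rw [roundLaw, ← Set.univ_pi_singleton, Measure.pi_pi,
      ENNReal.ofReal_prod_of_nonneg fun k _ => one_add_sign_mul_nonneg _ (habs _)]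
    simp_rw [signLaw_singleton]
  rw [integral_fintype .of_finite]
  simp_rw [hw, biasedCoeff, smul_eq_mul, ← integral_mul_const]
  rw [← integral_finsetSum _ fun w _ => (hint w).mul_const _]
  simp [mul_comm]

section Linear

variable {κ τ : Type*} [Fintype τ]

lemma measurable_mulVec (M : Matrix κ τ ℝ) : Measurable fun g : τ → ℝ => M *ᵥ g := by
  refine measurable_pi_iff.2 fun k => ?_
  simp only [mulVec, dotProduct]
  fun_prop

lemma integral_sq_mulVec (M : Matrix κ τ ℝ) (k : κ) :
    ∫ g, (M *ᵥ g) k ^ 2 ∂(stdGaussianPi τ) = (M * Mᵀ) k k := by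
  have hL : ∀ b, MemLp (fun x : ℝ => M k b * x) 2 (gaussianReal 0 1) := fun b =>
    (memLp_id_gaussianReal' 2 (by simp)).const_mul _
  have hv := variance_sum_pi (μ := fun _ : τ => gaussianReal 0 1) (X := fun b x => M k b * x) hL
  have h0 : ∫ g, (M *ᵥ g) k ∂(stdGaussianPi τ) = 0 := by
    simp only [mulVec, dotProduct]
    rw [integral_finsetSum _ fun b _ => (integrable_eval_stdGaussianPi b).const_mul _]
    refine Finset.sum_eq_zero fun b _ => ?_
    rw [integral_const_mul, integral_eval, integral_id_gaussianReal, mul_zero]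
  have he : (∑ b, fun g : τ → ℝ => M k b * g b) = fun g => (M *ᵥ g) k := by
    ext g; simp [mulVec, dotProduct]
  have hmk : Measurable fun g : τ → ℝ => (M *ᵥ g) k :=
    (measurable_pi_apply k).comp (measurable_mulVec M)
  rw [he, variance_of_integral_eq_zero hmk.aemeasurable h0] at hv
  rw [hv, mul_apply]
  refine Finset.sum_congr rfl fun b _ => ?_
  rw [variance_const_mul, variance_fun_id_gaussianReal]
  simp [pow_two]

lemma integrable_exp_mulVec (M : Matrix κ τ ℝ) (k : κ) (t : ℝ) :
    Integrable (fun g => Real.exp (t * (M *ᵥ g) k)) (stdGaussianPi τ) := by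
  have : (fun g : τ → ℝ => Real.exp (t * (M *ᵥ g) k)) =
      fun g => ∏ b, Real.exp ((t * M k b) * g b) := by
    ext g
    rw [← Real.exp_sum]
    simp [mulVec, dotProduct, Finset.mul_sum, mul_assoc]
  rw [this]
  exact Integrable.fintype_prod fun b => integrable_exp_mul_gaussianReal _

lemma integral_exp_mulVec (M : Matrix κ τ ℝ) (k : κ) (t : ℝ) :
    ∫ g, Real.exp (t * (M *ᵥ g) k) ∂(stdGaussianPi τ) =
      Real.exp (t ^ 2 * (M * Mᵀ) k k / 2) := by
  have : (fun g : τ → ℝ => Real.exp (t * (M *ᵥ g) k)) =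
      fun g => ∏ b, Real.exp ((t * M k b) * g b) := by
    ext g
    rw [← Real.exp_sum]
    simp [mulVec, dotProduct, Finset.mul_sum, mul_assoc]
  rw [this, integral_fintype_prod_eq_prod (f := fun b x => Real.exp ((t * M k b) * x))]
  have h : ∀ b, ∫ x, Real.exp ((t * M k b) * x) ∂(gaussianReal 0 1) =
      Real.exp ((t * M k b) ^ 2 / 2) := fun b => by
    have := congrFun (mgf_fun_id_gaussianReal (μ := 0) (v := 1)) (t * M k b)
    simpa [mgf] using this
  simp_rw [h, ← Real.exp_sum]
  congr 1
  simp only [mul_apply, transpose_apply, Finset.mul_sum, Finset.sum_div]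
  refine Finset.sum_congr rfl fun b _ => ?_
  ring

end Linear

open scoped MatrixOrder in
lemma exists_multivariateGaussian_eq_map {ι : Type*} [Fintype ι] [DecidableEq ι]
    {S : Matrix ι ι ℝ} (hS : S.PosSemidef) : ∃ A : Matrix ι ι ℝ, A * Aᵀ = S ∧
      multivariateGaussian 0 S = (stdGaussianPi ι).map fun g => WithLp.toLp 2 (A *ᵥ g) := by
  refine ⟨CFC.sqrt S, ?_, ?_⟩
  · have h : (CFC.sqrt S).IsHermitian := (CFC.sqrt_nonneg S).isSelfAdjoint
    have h' : (CFC.sqrt S)ᵀ = CFC.sqrt S := by simpa [IsHermitian] using h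
    rw [h', CFC.sqrt_mul_sqrt_self _ hS.nonneg]
  · rw [multivariateGaussian, ← map_pi_eq_stdGaussian, Measure.map_map (by fun_prop) (by fun_prop)]
    congr 1
    ext g
    simp [Matrix.toEuclideanCLM_toLp]

section Laws

variable {n : ℕ}

lemma hadamardMatrix_transpose : (hadamardMatrix n)ᵀ = hadamardMatrix n := by
  ext i j
  simp [hadamardMatrix, and_comm]

lemma stdGaussianPi_sum_map {ι τ : Type*} [Fintype ι] [Fintype τ] :
    (stdGaussianPi (ι ⊕ τ)).map (fun g => (fun i => g (Sum.inl i), fun j => g (Sum.inr j))) =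
      (stdGaussianPi ι).prod (stdGaussianPi τ) :=
  (measurePreserving_sumPiEquivProdPi fun _ : ι ⊕ τ => gaussianReal 0 1).map_eq

lemma yesGaussian_eq_map {S A : Matrix (Fin n → Bool) (Fin n → Bool) ℝ}
    (hA : multivariateGaussian 0 S =
      (stdGaussianPi (Fin n → Bool)).map fun g => WithLp.toLp 2 (A *ᵥ g)) :
    yesGaussian S = (stdGaussianPi ((Fin n → Bool) ⊕ (Fin n → Bool))).map
      fun g => fromBlocks A 0 (hadamardMatrix n * A) 0 *ᵥ g := by
  have h1 : stdGaussianPi (Fin n → Bool) =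
      (stdGaussianPi ((Fin n → Bool) ⊕ (Fin n → Bool))).map fun g i => g (Sum.inl i) := by
    have := congrArg (Measure.map Prod.fst)
      (stdGaussianPi_sum_map (ι := Fin n → Bool) (τ := Fin n → Bool))
    rw [Measure.map_map (by fun_prop) (by fun_prop), Measure.map_fst_prod] at this
    simpa [Function.comp_def] using this.symm
  have m1 : Measurable fun g : (Fin n → Bool) → ℝ => WithLp.toLp 2 (A *ᵥ g) :=
    (WithLp.measurable_toLp 2 _).comp (measurable_mulVec A)
  have m2 : Measurable fun x : EuclideanSpace ℝ (Fin n → Bool) =>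
      (Sum.elim x.ofLp (hadamardMatrix n *ᵥ x.ofLp) : (Fin n → Bool) ⊕ (Fin n → Bool) → ℝ) := by
    refine measurable_pi_iff.2 fun k => ?_
    have h := (measurable_mulVec (hadamardMatrix n)).comp
      (WithLp.measurable_ofLp 2 ((Fin n → Bool) → ℝ))
    rcases k with k | k
    · simp only [Sum.elim_inl]; fun_prop
    · exact (measurable_pi_apply k).comp h
  rw [yesGaussian, hA, h1, Measure.map_map m1 (by fun_prop),
    Measure.map_map m2 (m1.comp (by fun_prop))]
  congr 1
  ext g k
  simp only [Function.comp_def, fromBlocks_mulVec, zero_mulVec, add_zero, mulVec_mulVec]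

lemma noGaussian_eq_map {S A B : Matrix (Fin n → Bool) (Fin n → Bool) ℝ}
    (hA : multivariateGaussian 0 S =
      (stdGaussianPi (Fin n → Bool)).map fun g => WithLp.toLp 2 (A *ᵥ g))
    (hB : multivariateGaussian 0 (hadamardMatrix n * S * hadamardMatrix n) =
      (stdGaussianPi (Fin n → Bool)).map fun g => WithLp.toLp 2 (B *ᵥ g)) :
    noGaussian S = (stdGaussianPi ((Fin n → Bool) ⊕ (Fin n → Bool))).map
      fun g => fromBlocks A 0 0 B *ᵥ g := by
  have m1 : ∀ A : Matrix (Fin n → Bool) (Fin n → Bool) ℝ,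
      Measurable fun g : (Fin n → Bool) → ℝ => WithLp.toLp 2 (A *ᵥ g) := fun A =>
    (WithLp.measurable_toLp 2 _).comp (measurable_mulVec A)
  have m2 : Measurable fun p : EuclideanSpace ℝ (Fin n → Bool) × EuclideanSpace ℝ (Fin n → Bool) =>
      (Sum.elim p.1.ofLp p.2.ofLp : (Fin n → Bool) ⊕ (Fin n → Bool) → ℝ) := by
    refine measurable_pi_iff.2 fun k => ?_
    rcases k with k | k
    · simp only [Sum.elim_inl]; fun_prop
    · simp only [Sum.elim_inr]; fun_prop
  rw [noGaussian, hA, hB, Measure.map_prod_map _ _ (m1 A) (m1 B), ← stdGaussianPi_sum_map,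
    Measure.map_map ((m1 A).prodMap (m1 B)) (by fun_prop),
    Measure.map_map m2 (((m1 A).prodMap (m1 B)).comp (by fun_prop))]
  congr 1
  ext g k
  simp only [Function.comp_def, fromBlocks_mulVec, zero_mulVec, add_zero, zero_add, Prod.map]

/-- The map `(x, y) ↦ (x, y ^ 2 - v)`, coordinate by coordinate. -/
def squareShift {I : Type*} (v : I → ℝ) : I ⊕ I → ℝ → ℝ
  | Sum.inl _, x => x
  | Sum.inr i, y => y ^ 2 - v i

lemma integral_truncated_squareSecond {I : Type*} [Fintype I] [DecidableEq I]
    (M : Matrix (I ⊕ I) (I ⊕ I) ℝ) (F : SignCube (I ⊕ I) → ℝ) :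
    ∫ w, F w ∂(truncated (squareSecond ((stdGaussianPi (I ⊕ I)).map fun g => M *ᵥ g))) =
      ∫ g, biasedCoeff F ∅ (fun k => trnc (squareShift
        (fun i => (M * Mᵀ) (Sum.inr i) (Sum.inr i)) k ((M *ᵥ g) k))) ∂(stdGaussianPi (I ⊕ I)) := by
  have hm := measurable_mulVec M
  have hv : ∀ i : I, ∫ w, w (Sum.inr i) ^ 2 ∂((stdGaussianPi (I ⊕ I)).map fun g => M *ᵥ g) =
      (M * Mᵀ) (Sum.inr i) (Sum.inr i) := fun i => by
    rw [integral_map hm.aemeasurable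
      ((measurable_pi_apply (Sum.inr i)).pow_const 2).aestronglyMeasurable]
    exact integral_sq_mulVec M (Sum.inr i)
  have hs : Measurable fun z : I ⊕ I → ℝ => (Sum.elim (fun i => z (Sum.inl i))
      (fun i => z (Sum.inr i) ^ 2 - (M * Mᵀ) (Sum.inr i) (Sum.inr i)) : I ⊕ I → ℝ) := by
    refine measurable_pi_iff.2 fun k => ?_
    rcases k with k | k
    · simp only [Sum.elim_inl]; fun_prop
    · simp only [Sum.elim_inr]; fun_prop
  rw [squareSecond]
  simp_rw [hv]
  have := Measure.isProbabilityMeasure_map (μ := stdGaussianPi (I ⊕ I)) hm.aemeasurable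
  have := Measure.isProbabilityMeasure_map
    (μ := (stdGaussianPi (I ⊕ I)).map fun g => M *ᵥ g) hs.aemeasurable
  have hc : Measurable fun z : I ⊕ I → ℝ => biasedCoeff F ∅ fun k => trnc (z k) :=
    (continuous_biasedCoeff F ∅).measurable.comp
      (measurable_pi_iff.2 fun k => measurable_trnc.comp (measurable_pi_apply k))
  have hcs := hc.comp hs
  simp only [Function.comp_def] at hcs
  rw [integral_truncated, integral_map hs.aemeasurable hc.aestronglyMeasurable,
    integral_map hm.aemeasurable hcs.aestronglyMeasurable]
  congr 1
  ext g
  congr 1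
  ext k
  rcases k with k | k <;> rfl

end Laws

/-! ## Interpolation between the two laws -/

section Interpolation

variable {I : Type*}

/-- The derivative of `g ∘ squareShift v k`, where `s` is the derivative of `g`. -/
def squareShiftDeriv (s : ℝ → ℝ) (v : I → ℝ) : I ⊕ I → ℝ → ℝ
  | Sum.inl _, x => s x
  | Sum.inr i, y => s (y ^ 2 - v i) * (2 * y)

/-- The second derivative of `g ∘ squareShift v k`, where `s` is the derivative of `g`, and `s'`
the one of `s`. -/
def squareShiftDeriv2 (s s' : ℝ → ℝ) (v : I → ℝ) : I ⊕ I → ℝ → ℝ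
  | Sum.inl _, x => s' x
  | Sum.inr i, y => s' (y ^ 2 - v i) * (2 * y) * (2 * y) + s (y ^ 2 - v i) * 2

lemma abs_two_mul_le_three {y v : ℝ} (hv : v ≤ 1) (h : |y ^ 2 - v| < 1) : |2 * y| ≤ 3 := by
  have := (abs_lt.1 h).2
  refine abs_le_of_sq_le_sq ?_ (by norm_num)
  nlinarith

lemma SmoothTrnc.abs_deriv_le {g s s' : ℝ → ℝ} (h : SmoothTrnc g s s') (x : ℝ) : |s x| ≤ 1 := by
  rw [abs_of_nonneg (h.deriv_nonneg x)]; exact h.deriv_le x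

lemma SmoothTrnc.abs_squareShiftDeriv_le {g s s' : ℝ → ℝ} (h : SmoothTrnc g s s') {v : I → ℝ}
    (hv : ∀ i, v i ≤ 1) (k : I ⊕ I) (x : ℝ) : |squareShiftDeriv s v k x| ≤ 3 := by
  rcases k with i | i
  · exact (h.abs_deriv_le x).trans (by norm_num)
  · simp only [squareShiftDeriv]
    rcases lt_or_ge |x ^ 2 - v i| 1 with h1 | h1
    · rw [abs_mul]
      have := abs_two_mul_le_three (hv i) h1
      have := h.abs_deriv_le (x ^ 2 - v i)
      nlinarith [abs_nonneg (2 * x)]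
    · rw [h.deriv_eq_zero _ h1]; norm_num

lemma SmoothTrnc.abs_squareShiftDeriv_inl_le {g s s' : ℝ → ℝ} (h : SmoothTrnc g s s') (v : I → ℝ)
    (i : I) (x : ℝ) : |squareShiftDeriv s v (Sum.inl i) x| ≤ 1 :=
  h.abs_deriv_le x

lemma hasDerivAt_sq_sub (v y : ℝ) : HasDerivAt (fun y : ℝ => y ^ 2 - v) (2 * y) y := by
  simpa using (hasDerivAt_pow 2 y).sub_const v

lemma SmoothTrnc.hasDerivAt_squareShift {g s s' : ℝ → ℝ} (h : SmoothTrnc g s s') (v : I → ℝ)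
    (k : I ⊕ I) (x : ℝ) :
    HasDerivAt (fun x => g (squareShift v k x)) (squareShiftDeriv s v k x) x := by
  rcases k with i | i
  · exact h.hasDerivAt x
  · exact (h.hasDerivAt (x ^ 2 - v i)).comp x (hasDerivAt_sq_sub (v i) x)

lemma SmoothTrnc.hasDerivAt_squareShiftDeriv {g s s' : ℝ → ℝ} (h : SmoothTrnc g s s') (v : I → ℝ)
    (k : I ⊕ I) (x : ℝ) :
    HasDerivAt (squareShiftDeriv s v k) (squareShiftDeriv2 s s' v k x) x := by
  rcases k with i | i
  · exact h.hasDerivAt' x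
  · have h1 : HasDerivAt (fun y => s (y ^ 2 - v i)) (s' (x ^ 2 - v i) * (2 * x)) x :=
      (h.hasDerivAt' (x ^ 2 - v i)).comp x (hasDerivAt_sq_sub (v i) x)
    have h2 : HasDerivAt (fun y : ℝ => 2 * y) 2 x := by
      simpa using (hasDerivAt_id' x).const_mul 2
    exact h1.fun_mul h2

lemma SmoothTrnc.exists_abs_squareShiftDeriv2_le {g s s' : ℝ → ℝ} (h : SmoothTrnc g s s')
    {v : I → ℝ} (hv : ∀ i, v i ≤ 1) : ∃ D, ∀ k x, |squareShiftDeriv2 s s' v k x| ≤ D := by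
  obtain ⟨B, hB⟩ := h.exists_bound
  have hB0 : 0 ≤ B := (abs_nonneg _).trans (hB 0)
  refine ⟨9 * B + 2, fun k x => ?_⟩
  rcases k with i | i
  · exact (hB x).trans (by linarith)
  · simp only [squareShiftDeriv2]
    refine (abs_add_le _ _).trans (add_le_add ?_ ?_)
    · rcases lt_or_ge |x ^ 2 - v i| 1 with h1 | h1
      · rw [abs_mul, abs_mul]
        have h2 := abs_two_mul_le_three (hv i) h1
        have h3 := mul_le_mul (mul_le_mul (hB (x ^ 2 - v i)) h2 (abs_nonneg _) hB0) h2
          (abs_nonneg _) (by positivity)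
        linarith
      · rw [h.deriv2_eq_zero _ h1]
        simpa using hB0
    · rw [abs_mul]
      have := h.abs_deriv_le (x ^ 2 - v i)
      norm_num
      linarith

variable [Fintype I] [DecidableEq I]

/-- The factor at the coordinate `k` in the probability of rounding to `w`, as a function of the
corresponding Gaussian variable. -/
noncomputable def roundingFactor (g : ℝ → ℝ) (v : I → ℝ) (w : SignCube (I ⊕ I)) (k : I ⊕ I)
    (x : ℝ) : ℝ :=
  (1 + ((w k : ℤ) : ℝ) * g (squareShift v k x)) / 2

/-- The common form of the derivatives of `roundingFactor`. -/
noncomputable def signedHalf (d : I ⊕ I → ℝ → ℝ) (w : SignCube (I ⊕ I)) (k : I ⊕ I) (x : ℝ) : ℝ :=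
  ((w k : ℤ) : ℝ) * d k x / 2

lemma abs_sign_mul (s : ℤˣ) (a : ℝ) : |((s : ℤ) : ℝ) * a| = |a| := by
  rcases Int.units_eq_one_or s with rfl | rfl <;> simp

omit [Fintype I] [DecidableEq I] in
lemma SmoothTrnc.bddDeriv {g s s' : ℝ → ℝ} (h : SmoothTrnc g s s') {v : I → ℝ}
    (hv : ∀ i, v i ≤ 1) : ∃ B, ∀ w : SignCube (I ⊕ I),
      BddDeriv (roundingFactor g v w) (signedHalf (squareShiftDeriv s v) w) B ∧
      BddDeriv (signedHalf (squareShiftDeriv s v) w) (signedHalf (squareShiftDeriv2 s s' v) w) B := by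
  obtain ⟨D, hD⟩ := h.exists_abs_squareShiftDeriv2_le hv
  have hq : ∀ (w : SignCube (I ⊕ I)) k x, |signedHalf (squareShiftDeriv s v) w k x| ≤ 3 := by
    intro w k x
    rw [signedHalf, abs_div, abs_sign_mul, abs_two]
    linarith [h.abs_squareShiftDeriv_le hv k x]
  refine ⟨max 3 D, fun w => ⟨⟨fun k x => ?_, fun k x => ?_, fun k x => ?_⟩,
    ⟨fun k x => ?_, fun k x => ?_, fun k x => ?_⟩⟩⟩
  · exact (((h.hasDerivAt_squareShift v k x).const_mul _).const_add 1).div_const 2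
  · refine le_trans ?_ (le_max_left 3 D)
    rw [roundingFactor, abs_div, abs_two]
    have h1 := abs_add_le 1 (((w k : ℤ) : ℝ) * g (squareShift v k x))
    rw [abs_sign_mul, abs_one] at h1
    linarith [h.abs_le_one (squareShift v k x)]
  · exact (hq w k x).trans (le_max_left _ _)
  · exact ((h.hasDerivAt_squareShiftDeriv v k x).const_mul _).div_const 2
  · exact (hq w k x).trans (le_max_left _ _)
  · refine le_trans ?_ (le_max_right 3 D)
    rw [signedHalf, abs_div, abs_sign_mul, abs_two]
    linarith [hD k x, abs_nonneg (squareShiftDeriv2 s s' v k x)]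

lemma sum_mul_prodFun_roundingFactor (F : SignCube (I ⊕ I) → ℝ) (g : ℝ → ℝ) (v : I → ℝ)
    (z : I ⊕ I → ℝ) :
    ∑ w, F w * prodFun (roundingFactor g v w) z =
      biasedCoeff F ∅ fun k => g (squareShift v k (z k)) := by
  simp [biasedCoeff, prodFun, roundingFactor]

lemma sum_mul_prodFun_update_update (F : SignCube (I ⊕ I) → ℝ) (g s : ℝ → ℝ) (v : I → ℝ)
    (z : I ⊕ I → ℝ) (i j : I) (r : SignCube (I ⊕ I) → ℝ → ℝ) :
    ∑ w, F w * prodFun (Function.update (Function.update (roundingFactor g v w) (Sum.inr j)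
        (signedHalf (squareShiftDeriv s v) w (Sum.inr j))) (Sum.inl i)
        ((Function.update (signedHalf (squareShiftDeriv s v) w) (Sum.inr j) (r w)) (Sum.inl i))) z =
      squareShiftDeriv s v (Sum.inl i) (z (Sum.inl i)) *
        squareShiftDeriv s v (Sum.inr j) (z (Sum.inr j)) *
        biasedCoeff F {Sum.inl i, Sum.inr j} fun k => g (squareShift v k (z k)) := by
  rw [biasedCoeff, Finset.mul_sum]
  refine Finset.sum_congr rfl fun w _ => ?_
  rw [mul_left_comm]
  congr 1
  have h : squareShiftDeriv s v (Sum.inl i) (z (Sum.inl i)) *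
      squareShiftDeriv s v (Sum.inr j) (z (Sum.inr j)) =
      ∏ k, if k ∈ ({Sum.inl i, Sum.inr j} : Finset (I ⊕ I)) then
        squareShiftDeriv s v k (z k) else 1 := by
    rw [Finset.prod_ite_mem, Finset.univ_inter, Finset.prod_pair (by simp)]
  rw [h, ← Finset.prod_mul_distrib, prodFun]
  refine Finset.prod_congr rfl fun k _ => ?_
  by_cases h1 : k = Sum.inl i
  · subst h1; simp [signedHalf]; ring
  · by_cases h2 : k = Sum.inr j
    · subst h2; simp [signedHalf]; ring
    · simp [h1, h2, roundingFactor]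

/-- The interpolating path of linear maps. -/
noncomputable def interpolation (A B B' : Matrix I I ℝ) (t : ℝ) : Matrix (I ⊕ I) (I ⊕ I) ℝ :=
  fromBlocks A 0 (Real.sin t • B') (Real.cos t • B)

/-- The derivative of `interpolation`. -/
noncomputable def interpolationDeriv (B B' : Matrix I I ℝ) (t : ℝ) : Matrix (I ⊕ I) (I ⊕ I) ℝ :=
  fromBlocks 0 0 (Real.cos t • B') (-Real.sin t • B)

omit [Fintype I] [DecidableEq I] in
lemma hasDerivAt_interpolation (A B B' : Matrix I I ℝ) (t : ℝ) (a b : I ⊕ I) :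
    HasDerivAt (fun s => interpolation A B B' s a b) (interpolationDeriv B B' t a b) t := by
  rcases a with a | a <;> rcases b with b | b
  · simpa [interpolation, interpolationDeriv] using hasDerivAt_const t (A a b)
  · simpa [interpolation, interpolationDeriv] using hasDerivAt_const t (0 : ℝ)
  · simpa [interpolation, interpolationDeriv] using (Real.hasDerivAt_sin t).mul_const (B' a b)
  · simpa [interpolation, interpolationDeriv] using (Real.hasDerivAt_cos t).mul_const (B a b)

omit [DecidableEq I] in
lemma exists_abs_interpolationDeriv_le (B B' : Matrix I I ℝ) :
    ∃ D, ∀ t a b, |interpolationDeriv B B' t a b| ≤ D := by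
  have hs : ∀ (E : Matrix I I ℝ) a b, |E a b| ≤ ∑ a, ∑ b, |E a b| := fun E a b =>
    (Finset.single_le_sum (f := fun b => |E a b|) (fun _ _ => abs_nonneg _)
      (Finset.mem_univ b)).trans (Finset.single_le_sum (f := fun a => ∑ b, |E a b|)
        (fun _ _ => Finset.sum_nonneg fun _ _ => abs_nonneg _) (Finset.mem_univ a))
  have h0 : ∀ E : Matrix I I ℝ, 0 ≤ ∑ a, ∑ b, |E a b| := fun E =>
    Finset.sum_nonneg fun _ _ => Finset.sum_nonneg fun _ _ => abs_nonneg _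
  have hm : ∀ (c : ℝ) (E : Matrix I I ℝ) a b, |c| ≤ 1 → |c * E a b| ≤ ∑ a, ∑ b, |E a b| :=
    fun c E a b hc => by
      rw [abs_mul]
      exact (mul_le_of_le_one_left (abs_nonneg _) hc).trans (hs E a b)
  refine ⟨(∑ a, ∑ b, |B a b|) + ∑ a, ∑ b, |B' a b|, fun t a b => ?_⟩
  have h1 := h0 B
  have h2 := h0 B'
  rcases a with a | a <;> rcases b with b | b
  · simp only [interpolationDeriv, fromBlocks_apply₁₁, Matrix.zero_apply, abs_zero]; linarith
  · simp only [interpolationDeriv, fromBlocks_apply₁₂, Matrix.zero_apply, abs_zero]; linarith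
  · simp only [interpolationDeriv, fromBlocks_apply₂₁, Matrix.smul_apply, smul_eq_mul]
    linarith [hm (Real.cos t) B' a b (Real.abs_cos_le_one t)]
  · simp only [interpolationDeriv, fromBlocks_apply₂₂, Matrix.smul_apply, smul_eq_mul]
    linarith [hm (-Real.sin t) B a b (by rw [abs_neg]; exact Real.abs_sin_le_one t)]

omit [DecidableEq I] in
lemma interpolationDeriv_mul_transpose (A : Matrix I I ℝ) {B B' : Matrix I I ℝ}
    (hB : B * Bᵀ = B' * B'ᵀ) (t : ℝ) :
    interpolationDeriv B B' t * (interpolation A B B' t)ᵀ =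
      fromBlocks 0 0 (Real.cos t • (B' * Aᵀ)) 0 := by
  rw [interpolation, interpolationDeriv, fromBlocks_transpose, fromBlocks_multiply]
  congr 1 <;> simp [hB, smul_smul, mul_comm]

omit [DecidableEq I] in
lemma interpolation_mul_transpose_inl (A B B' : Matrix I I ℝ) (t : ℝ) (i : I) :
    (interpolation A B B' t * (interpolation A B B' t)ᵀ) (Sum.inl i) (Sum.inl i) =
      (A * Aᵀ) i i := by
  rw [interpolation, fromBlocks_transpose, fromBlocks_multiply, fromBlocks_apply₁₁]
  simp

omit [DecidableEq I] in
lemma interpolation_mul_transpose_inr (A : Matrix I I ℝ) {B B' : Matrix I I ℝ}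
    (hB : B * Bᵀ = B' * B'ᵀ) (t : ℝ) (i : I) :
    (interpolation A B B' t * (interpolation A B B' t)ᵀ) (Sum.inr i) (Sum.inr i) =
      (B * Bᵀ) i i := by
  rw [interpolation, fromBlocks_transpose, fromBlocks_multiply, fromBlocks_apply₂₂]
  simp only [transpose_smul, Matrix.smul_mul, Matrix.mul_smul, smul_smul, ← hB, ← add_smul,
    Matrix.smul_apply, smul_eq_mul]
  rw [← pow_two, ← pow_two, Real.sin_sq_add_cos_sq, one_mul]

/-- The sum of the absolute values of the mixed second derivatives, at a point. -/
noncomputable def mixedDerivSum (F : SignCube (I ⊕ I) → ℝ) (g s : ℝ → ℝ) (v : I → ℝ)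
    (z : I ⊕ I → ℝ) : ℝ :=
  ∑ j, ∑ i, |squareShiftDeriv s v (Sum.inl i) (z (Sum.inl i)) *
    squareShiftDeriv s v (Sum.inr j) (z (Sum.inr j)) *
    biasedCoeff F {Sum.inl i, Sum.inr j} fun k => g (squareShift v k (z k))|

lemma mixedDerivSum_le {F : SignCube (I ⊕ I) → ℝ} {l : ℝ}
    (hl : ∀ ρ : I ⊕ I → Option ℤˣ, levelMass 2 (restrictBy F ρ) ≤ l) (hl0 : 0 ≤ l)
    {g s s' : ℝ → ℝ} (h : SmoothTrnc g s s') {v : I → ℝ} (hv0 : ∀ i, 0 ≤ v i)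
    (hv : ∀ i, v i ≤ 1 / 4) {c : ℝ} (hc : 0 ≤ c) (z : I ⊕ I → ℝ) :
    mixedDerivSum F g s v z ≤ 12 * l + 3 * l * (Fintype.card I : ℝ) ^ 2 *
      ∑ k, (Real.exp (c * z k) * Real.exp (-c / 4) + Real.exp (-c * z k) * Real.exp (-c / 4)) := by
  have hfac : ∀ (i j : I) (b : ℝ), |squareShiftDeriv s v (Sum.inl i) (z (Sum.inl i)) *
      squareShiftDeriv s v (Sum.inr j) (z (Sum.inr j)) * b| ≤ 3 * |b| := fun i j b => by
    rw [abs_mul, abs_mul]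
    refine mul_le_mul_of_nonneg_right ?_ (abs_nonneg _)
    calc _ ≤ (1 : ℝ) * 3 := mul_le_mul (h.abs_squareShiftDeriv_inl_le v i _)
          (h.abs_squareShiftDeriv_le (fun i => (hv i).trans (by norm_num)) _ _)
          (abs_nonneg _) zero_le_one
      _ = 3 := one_mul 3
  have hexp : ∀ k, 0 ≤ Real.exp (c * z k) * Real.exp (-c / 4) +
      Real.exp (-c * z k) * Real.exp (-c / 4) := fun k => by positivity
  set u : I ⊕ I → ℝ := fun k => g (squareShift v k (z k)) with hu
  by_cases hz : ∀ k, |z k| ≤ 1 / 4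
  · have hu' : ∀ k, |u k| ≤ 1 / 2 := fun k => by
      refine (h.abs_le_abs _).trans ?_
      rcases k with i | i
      · exact (hz _).trans (by norm_num)
      · have h1 := abs_le.1 (hz (Sum.inr i))
        have h2 := hv0 i
        have h3 := hv i
        simp only [squareShift]
        exact abs_le.2 ⟨by nlinarith, by nlinarith⟩
    have h1 : mixedDerivSum F g s v z ≤ 3 * (4 * l) := by
      rw [mixedDerivSum, Finset.sum_comm]
      refine le_trans ?_ (mul_le_mul_of_nonneg_left (sum_abs_biasedCoeff_pair_le hl hu')
        (by norm_num : (0 : ℝ) ≤ 3))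
      simp_rw [Finset.mul_sum]
      exact Finset.sum_le_sum fun i _ => Finset.sum_le_sum fun j _ => hfac i j _
    have h2 : 0 ≤ 3 * l * (Fintype.card I : ℝ) ^ 2 *
      ∑ k, (Real.exp (c * z k) * Real.exp (-c / 4) + Real.exp (-c * z k) * Real.exp (-c / 4)) :=
      mul_nonneg (by positivity) (Finset.sum_nonneg fun k _ => hexp k)
    linarith
  · push Not at hz
    obtain ⟨k, hk⟩ := hz
    have h1 : mixedDerivSum F g s v z ≤ 3 * l * (Fintype.card I : ℝ) ^ 2 := by
      calc mixedDerivSum F g s v z ≤ ∑ _j : I, ∑ _i : I, 3 * l :=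
            Finset.sum_le_sum fun j _ => Finset.sum_le_sum fun i _ => (hfac i j _).trans
              (mul_le_mul_of_nonneg_left (abs_biasedCoeff_le hl (fun k => h.abs_le_one _)
                (Finset.card_pair (by simp))) (by norm_num))
        _ = 3 * l * (Fintype.card I : ℝ) ^ 2 := by simp; ring
    have h2 : 1 ≤ ∑ k, (Real.exp (c * z k) * Real.exp (-c / 4) +
        Real.exp (-c * z k) * Real.exp (-c / 4)) := by
      refine le_trans ?_ (Finset.single_le_sum (fun k _ => hexp k) (Finset.mem_univ k))
      rw [← Real.exp_add, ← Real.exp_add]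
      rcases lt_abs.1 hk with h3 | h3
      · have := Real.one_le_exp (show 0 ≤ c * z k + -c / 4 by nlinarith)
        linarith [Real.exp_pos (-c * z k + -c / 4)]
      · have := Real.one_le_exp (show 0 ≤ -c * z k + -c / 4 by nlinarith)
        linarith [Real.exp_pos (c * z k + -c / 4)]
    have h3 : 0 ≤ 3 * l * (Fintype.card I : ℝ) ^ 2 := by positivity
    nlinarith

lemma integral_mixedDerivSum_le {F : SignCube (I ⊕ I) → ℝ} {l : ℝ}
    (hl : ∀ ρ : I ⊕ I → Option ℤˣ, levelMass 2 (restrictBy F ρ) ≤ l) (hl0 : 0 ≤ l)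
    {g s s' : ℝ → ℝ} (h : SmoothTrnc g s s') {v : I → ℝ} (hv0 : ∀ i, 0 ≤ v i)
    (hv : ∀ i, v i ≤ 1 / 4) {ε : ℝ} (hε : 0 < ε)
    (hcard : 4 * (Fintype.card I : ℝ) ^ 3 * Real.exp (-1 / (32 * ε)) ≤ 1)
    {M : Matrix (I ⊕ I) (I ⊕ I) ℝ} (hM : ∀ k, (M * Mᵀ) k k ≤ ε)
    (hint : Integrable (fun x => mixedDerivSum F g s v (M *ᵥ x)) (stdGaussianPi (I ⊕ I))) :
    ∫ x, mixedDerivSum F g s v (M *ᵥ x) ∂(stdGaussianPi (I ⊕ I)) ≤ 15 * l := by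
  set c : ℝ := 1 / (4 * ε) with hc
  have hc0 : 0 ≤ c := by positivity
  have hi : ∀ (t : ℝ) (k : I ⊕ I), Integrable (fun x => Real.exp (t * (M *ᵥ x) k) *
      Real.exp (-c / 4)) (stdGaussianPi (I ⊕ I)) := fun t k =>
    (integrable_exp_mulVec M k t).mul_const _
  have hadd : ∀ k : I ⊕ I, Integrable (fun x => Real.exp (c * (M *ᵥ x) k) * Real.exp (-c / 4) +
      Real.exp (-c * (M *ᵥ x) k) * Real.exp (-c / 4)) (stdGaussianPi (I ⊕ I)) := fun k =>
    (hi c k).add (hi (-c) k)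
  have hsum : Integrable (fun x => ∑ k, (Real.exp (c * (M *ᵥ x) k) * Real.exp (-c / 4) +
      Real.exp (-c * (M *ᵥ x) k) * Real.exp (-c / 4))) (stdGaussianPi (I ⊕ I)) :=
    integrable_finsetSum _ fun k _ => hadd k
  have hone : ∀ (t : ℝ) (k : I ⊕ I), t ^ 2 = c ^ 2 → ∫ x, Real.exp (t * (M *ᵥ x) k) *
      Real.exp (-c / 4) ∂(stdGaussianPi (I ⊕ I)) ≤ Real.exp (-1 / (32 * ε)) := fun t k ht => by
    rw [integral_mul_const, integral_exp_mulVec, ← Real.exp_add, ht]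
    refine Real.exp_le_exp.2 ?_
    have h1 : c ^ 2 * (M * Mᵀ) k k ≤ c ^ 2 * ε := mul_le_mul_of_nonneg_left (hM k) (sq_nonneg c)
    have h2 : c ^ 2 * ε / 2 + -c / 4 = -1 / (32 * ε) := by rw [hc]; field_simp; norm_num
    linarith
  calc ∫ x, mixedDerivSum F g s v (M *ᵥ x) ∂(stdGaussianPi (I ⊕ I))
      ≤ ∫ x, (12 * l + 3 * l * (Fintype.card I : ℝ) ^ 2 *
          ∑ k, (Real.exp (c * (M *ᵥ x) k) * Real.exp (-c / 4) +
            Real.exp (-c * (M *ᵥ x) k) * Real.exp (-c / 4))) ∂(stdGaussianPi (I ⊕ I)) :=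
        integral_mono hint ((integrable_const _).add (hsum.const_mul _))
          fun x => mixedDerivSum_le hl hl0 h hv0 hv hc0 _
    _ = 12 * l + 3 * l * (Fintype.card I : ℝ) ^ 2 *
          ∑ k, (∫ x, Real.exp (c * (M *ᵥ x) k) * Real.exp (-c / 4) ∂(stdGaussianPi (I ⊕ I)) +
            ∫ x, Real.exp (-c * (M *ᵥ x) k) * Real.exp (-c / 4) ∂(stdGaussianPi (I ⊕ I))) := by
        rw [integral_add (integrable_const _) (hsum.const_mul _), integral_const, integral_const_mul,
          integral_finsetSum _ fun k _ => hadd k]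
        simp_rw [fun k => integral_add (hi c k) (hi (-c) k)]
        simp
    _ ≤ 12 * l + 3 * l * (Fintype.card I : ℝ) ^ 2 *
          ∑ _k : I ⊕ I, (Real.exp (-1 / (32 * ε)) + Real.exp (-1 / (32 * ε))) := by
        gcongr with k
        · exact hone c k rfl
        · exact hone (-c) k (neg_sq c)
    _ = 12 * l + 3 * l * (4 * (Fintype.card I : ℝ) ^ 3 * Real.exp (-1 / (32 * ε))) := by
        simp; ring
    _ ≤ 12 * l + 3 * l * 1 := by gcongr
    _ = 15 * l := by ring

lemma abs_integral_biasedCoeff_sub_le {F : SignCube (I ⊕ I) → ℝ} {l : ℝ}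
    (hl : ∀ ρ : I ⊕ I → Option ℤˣ, levelMass 2 (restrictBy F ρ) ≤ l) (hl0 : 0 ≤ l)
    {g s s' : ℝ → ℝ} (h : SmoothTrnc g s s') {A B B' : Matrix I I ℝ} (hB : B * Bᵀ = B' * B'ᵀ)
    {v : I → ℝ} (hv : ∀ i, v i = (B * Bᵀ) i i) {ε β : ℝ} (hε : 0 < ε) (hε' : ε ≤ 1 / 4)
    (hcard : 4 * (Fintype.card I : ℝ) ^ 3 * Real.exp (-1 / (32 * ε)) ≤ 1)
    (hAε : ∀ i, (A * Aᵀ) i i ≤ ε) (hBε : ∀ i, (B * Bᵀ) i i ≤ ε) (hβ0 : 0 ≤ β)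
    (hβ : ∀ i j, |(B' * Aᵀ) j i| ≤ β) :
    |∫ x, biasedCoeff F ∅ (fun k => g (squareShift v k
        ((interpolation A B B' (Real.pi / 2) *ᵥ x) k))) ∂(stdGaussianPi (I ⊕ I)) -
      ∫ x, biasedCoeff F ∅ (fun k => g (squareShift v k
        ((interpolation A B B' 0 *ᵥ x) k))) ∂(stdGaussianPi (I ⊕ I))| ≤ 30 * β * l := by
  have hv0 : ∀ i, 0 ≤ v i := fun i => by
    rw [hv, mul_apply]
    exact Finset.sum_nonneg fun b _ => mul_self_nonneg _
  have hv4 : ∀ i, v i ≤ 1 / 4 := fun i => by rw [hv]; exact (hBε i).trans hε'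
  have hv1 : ∀ i, v i ≤ 1 := fun i => (hv4 i).trans (by norm_num)
  obtain ⟨K, hK⟩ := h.bddDeriv hv1
  obtain ⟨D, hD⟩ := exists_abs_interpolationDeriv_le B B'
  set γ := stdGaussianPi (I ⊕ I)
  set M := interpolation A B B'
  let q := fun w : SignCube (I ⊕ I) => signedHalf (squareShiftDeriv s v) w
  let pp := fun (w : SignCube (I ⊕ I)) (a c : I ⊕ I) => Function.update (Function.update
    (roundingFactor g v w) a (q w a)) c ((Function.update (q w) a
      (signedHalf (squareShiftDeriv2 s s' v) w a)) c)
  have hmp : ∀ w a c, Measurable (prodFun (pp w a c)) := fun w a c =>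
    measurable_update_deriv ((hK w).1.update (hK w).2 a) c
  have hpi : ∀ w a c t, Integrable (fun x => prodFun (pp w a c) (M t *ᵥ x)) γ := fun w a c t =>
    Integrable.of_measurable_of_abs_le ((hmp w a c).comp (measurable_mulVec _))
      fun x => abs_update_deriv_le ((hK w).1.update (hK w).2 a) c _
  let J := fun (t : ℝ) (j i : I) (x : I ⊕ I → ℝ) =>
    squareShiftDeriv s v (Sum.inl i) ((M t *ᵥ x) (Sum.inl i)) *
      squareShiftDeriv s v (Sum.inr j) ((M t *ᵥ x) (Sum.inr j)) *
      biasedCoeff F {Sum.inl i, Sum.inr j} fun k => g (squareShift v k ((M t *ᵥ x) k))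
  have hJ : ∀ t j i x, J t j i x =
      ∑ w, F w * prodFun (pp w (Sum.inr j) (Sum.inl i)) (M t *ᵥ x) := fun t j i x =>
    (sum_mul_prodFun_update_update F g s v (M t *ᵥ x) i j
      fun w => signedHalf (squareShiftDeriv2 s s' v) w (Sum.inr j)).symm
  have hJi : ∀ t j i, Integrable (J t j i) γ := fun t j i => by
    rw [show J t j i = _ from funext (hJ t j i)]
    exact integrable_finsetSum _ fun w _ => (hpi w _ _ t).const_mul _
  have hder : ∀ t, HasDerivAt
      (fun t => ∑ w, F w * ∫ x, prodFun (roundingFactor g v w) (M t *ᵥ x) ∂γ)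
      (Real.cos t * ∑ j, ∑ i, (B' * Aᵀ) j i * ∫ x, J t j i x ∂γ) t := fun t => by
    have h1 := HasDerivAt.fun_sum (u := Finset.univ) fun (w : SignCube (I ⊕ I)) _ =>
      (hasDerivAt_integral_prodFun_mulVec (hK w).1 (hK w).2
        (hasDerivAt_interpolation A B B') hD t).const_mul (F w)
    refine h1.congr_deriv ?_
    rw [interpolationDeriv_mul_transpose A hB]
    simp only [Fintype.sum_sum_type, fromBlocks_apply₁₁, fromBlocks_apply₁₂, fromBlocks_apply₂₁,
      fromBlocks_apply₂₂, Matrix.zero_apply, zero_mul, Finset.sum_const_zero, zero_add, add_zero,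
      Matrix.smul_apply, smul_eq_mul]
    have h2 : ∀ j i, ∫ x, J t j i x ∂γ =
        ∑ w, F w * ∫ x, prodFun (pp w (Sum.inr j) (Sum.inl i)) (M t *ᵥ x) ∂γ := fun j i => by
      rw [integral_congr_ae (Filter.Eventually.of_forall (hJ t j i)),
        integral_finsetSum _ fun w _ => (hpi w _ _ t).const_mul _]
      simp_rw [integral_const_mul]
    simp_rw [h2, Finset.mul_sum]
    rw [Finset.sum_comm]
    refine Finset.sum_congr rfl fun j _ => ?_
    rw [Finset.sum_comm]
    refine Finset.sum_congr rfl fun i _ => Finset.sum_congr rfl fun w _ => ?_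
    simp only [pp, q]
    ring
  have hbound : ∀ t, ‖Real.cos t * ∑ j, ∑ i, (B' * Aᵀ) j i * ∫ x, J t j i x ∂γ‖ ≤
      β * (15 * l) := fun t => by
    have hMε : ∀ k, (M t * (M t)ᵀ) k k ≤ ε := by
      rintro (i | i)
      · exact (interpolation_mul_transpose_inl A B B' t i).trans_le (hAε i)
      · exact (interpolation_mul_transpose_inr A hB t i).trans_le (hBε i)
    have hsum : ∀ x, mixedDerivSum F g s v (M t *ᵥ x) = ∑ j, ∑ i, |J t j i x| := fun x => rfl
    have hint : Integrable (fun x => mixedDerivSum F g s v (M t *ᵥ x)) γ := by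
      simp_rw [hsum]
      exact integrable_finsetSum _ fun j _ => integrable_finsetSum _ fun i _ => (hJi t j i).abs
    have h1 := integral_mixedDerivSum_le hl hl0 h hv0 hv4 hε hcard hMε hint
    simp_rw [hsum] at h1
    rw [integral_finsetSum _ fun j _ => integrable_finsetSum _ fun i _ => (hJi t j i).abs] at h1
    simp_rw [fun j => integral_finsetSum (μ := γ) Finset.univ
      fun i (_ : i ∈ Finset.univ) => (hJi t j i).abs] at h1
    rw [norm_mul, Real.norm_eq_abs, Real.norm_eq_abs]
    refine (mul_le_of_le_one_left (abs_nonneg _) (Real.abs_cos_le_one t)).trans ?_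
    refine le_trans ?_ (mul_le_mul_of_nonneg_left h1 hβ0)
    simp_rw [Finset.mul_sum]
    refine (Finset.abs_sum_le_sum_abs _ _).trans (Finset.sum_le_sum fun j _ => ?_)
    refine (Finset.abs_sum_le_sum_abs _ _).trans (Finset.sum_le_sum fun i _ => ?_)
    rw [abs_mul]
    exact mul_le_mul (hβ i j) (abs_integral_le_integral_abs) (abs_nonneg _) hβ0
  have hval : ∀ t, ∫ x, biasedCoeff F ∅ (fun k => g (squareShift v k ((M t *ᵥ x) k))) ∂γ =
      ∑ w, F w * ∫ x, prodFun (roundingFactor g v w) (M t *ᵥ x) ∂γ := fun t => by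
    simp_rw [← sum_mul_prodFun_roundingFactor]
    rw [integral_finsetSum]
    · simp_rw [integral_const_mul]
    · exact fun w _ => (Integrable.of_measurable_of_abs_le
        ((measurable_prodFun (hK w).1.measurable).comp (measurable_mulVec _))
        fun x => abs_prodFun_le (hK w).1.abs_le _).const_mul _
  rw [hval, hval, ← Real.norm_eq_abs]
  have hmv := Convex.norm_image_sub_le_of_norm_hasDerivWithin_le (s := Set.univ) (x := 0)
    (y := Real.pi / 2) (fun t _ => (hder t).hasDerivWithinAt) (fun t _ => hbound t) convex_univ
    (Set.mem_univ _) (Set.mem_univ _)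
  refine hmv.trans ?_
  rw [sub_zero, Real.norm_eq_abs, abs_of_pos (by positivity)]
  have hpi4 := Real.pi_le_four
  have hβl : 0 ≤ β * l := mul_nonneg hβ0 hl0
  nlinarith

end Interpolation

section Trnc

variable {I : Type*} [Fintype I] [DecidableEq I]

lemma abs_biasedCoeff_empty_le (F : SignCube (I ⊕ I) → ℝ) {u : I ⊕ I → ℝ} (hu : ∀ k, |u k| ≤ 1) :
    |biasedCoeff F ∅ u| ≤ ∑ w, |F w| := by
  refine (Finset.abs_sum_le_sum_abs _ _).trans (Finset.sum_le_sum fun w _ => ?_)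
  rw [abs_mul, Finset.abs_prod]
  refine mul_le_of_le_one_right (abs_nonneg _)
    (Finset.prod_le_one (fun _ _ => abs_nonneg _) fun k _ => ?_)
  have h1 := abs_add_le 1 (((w k : ℤ) : ℝ) * u k)
  rw [abs_sign_mul, abs_one] at h1
  simp only [Finset.notMem_empty, if_false, abs_div, abs_two]
  linarith [hu k]

omit [Fintype I] [DecidableEq I] in
lemma measurable_squareShift (v : I → ℝ) (k : I ⊕ I) : Measurable (squareShift v k) := by
  rcases k with i | i
  · exact measurable_id
  · exact (measurable_id.pow_const 2).sub_const (v i)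

lemma tendsto_integral_biasedCoeff (F : SignCube (I ⊕ I) → ℝ) {g : ℕ → ℝ → ℝ}
    (hg : ∀ k, Measurable (g k)) (hg1 : ∀ k x, |g k x| ≤ 1)
    (hlim : ∀ x, Filter.Tendsto (fun k => g k x) Filter.atTop (nhds (trnc x))) (v : I → ℝ)
    (M : Matrix (I ⊕ I) (I ⊕ I) ℝ) :
    Filter.Tendsto (fun k => ∫ x, biasedCoeff F ∅ (fun a => g k (squareShift v a ((M *ᵥ x) a)))
        ∂(stdGaussianPi (I ⊕ I))) Filter.atTop
      (nhds (∫ x, biasedCoeff F ∅ (fun a => trnc (squareShift v a ((M *ᵥ x) a)))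
        ∂(stdGaussianPi (I ⊕ I)))) := by
  refine tendsto_integral_of_dominated_convergence (fun _ => ∑ w, |F w|) (fun k => ?_)
    (integrable_const _) (fun k => Filter.Eventually.of_forall fun x =>
      abs_biasedCoeff_empty_le F fun a => hg1 k _)
    (Filter.Eventually.of_forall fun x => ?_)
  · refine ((continuous_biasedCoeff F ∅).measurable.comp
      (measurable_pi_iff.2 fun a => ?_)).aestronglyMeasurable
    exact (hg k).comp ((measurable_squareShift v a).comp
      ((measurable_pi_apply a).comp (measurable_mulVec M)))
  · exact ((continuous_biasedCoeff F ∅).tendsto _).comp (tendsto_pi_nhds.2 fun a => hlim _)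

lemma abs_integral_biasedCoeff_trnc_sub_le {F : SignCube (I ⊕ I) → ℝ} {l : ℝ}
    (hl : ∀ ρ : I ⊕ I → Option ℤˣ, levelMass 2 (restrictBy F ρ) ≤ l)
    {A B B' : Matrix I I ℝ} (hB : B * Bᵀ = B' * B'ᵀ)
    {v : I → ℝ} (hv : ∀ i, v i = (B * Bᵀ) i i) {ε β : ℝ} (hε : 0 < ε) (hε' : ε ≤ 1 / 4)
    (hcard : 4 * (Fintype.card I : ℝ) ^ 3 * Real.exp (-1 / (32 * ε)) ≤ 1)
    (hAε : ∀ i, (A * Aᵀ) i i ≤ ε) (hBε : ∀ i, (B * Bᵀ) i i ≤ ε) (hβ0 : 0 ≤ β)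
    (hβ : ∀ i j, |(B' * Aᵀ) j i| ≤ β) :
    |∫ x, biasedCoeff F ∅ (fun k => trnc (squareShift v k
        ((interpolation A B B' (Real.pi / 2) *ᵥ x) k))) ∂(stdGaussianPi (I ⊕ I)) -
      ∫ x, biasedCoeff F ∅ (fun k => trnc (squareShift v k
        ((interpolation A B B' 0 *ᵥ x) k))) ∂(stdGaussianPi (I ⊕ I))| ≤ 30 * β * l := by
  have hl0 : 0 ≤ l := le_trans (Finset.sum_nonneg fun _ _ => abs_nonneg _) (hl fun _ => none)
  have hδ : ∀ k : ℕ, (0 : ℝ) < 1 / ((k : ℝ) + 2) ∧ 1 / ((k : ℝ) + 2) < 1 := fun k => by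
    refine ⟨by positivity, ?_⟩
    rw [div_lt_one (by positivity)]
    linarith [(Nat.cast_nonneg k : (0 : ℝ) ≤ k)]
  choose g s s' hg hgt using fun k : ℕ => exists_smoothTrnc (hδ k).1 (hδ k).2
  have hgm : ∀ k, Measurable (g k) := fun k =>
    (continuous_iff_continuousAt.2 fun x => ((hg k).hasDerivAt x).continuousAt).measurable
  have hlim : ∀ x, Filter.Tendsto (fun k => g k x) Filter.atTop (nhds (trnc x)) := fun x => by
    rw [tendsto_iff_norm_sub_tendsto_zero]
    refine squeeze_zero (fun k => norm_nonneg _) (fun k => hgt k x) ?_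
    have h1 := (Filter.tendsto_add_atTop_iff_nat 1).2
      (tendsto_one_div_add_atTop_nhds_zero_nat (𝕜 := ℝ))
    refine h1.congr fun k => ?_
    push_cast
    ring
  have ht := fun t => tendsto_integral_biasedCoeff F hgm (fun k => (hg k).abs_le_one) hlim v
    (interpolation A B B' t)
  exact le_of_tendsto ((ht (Real.pi / 2)).sub (ht 0)).abs (Filter.Eventually.of_forall fun k =>
    abs_integral_biasedCoeff_sub_le hl hl0 (hg k) hB hv hε hε' hcard hAε hBε hβ0 hβ)

end Trnc

lemma four_mul_two_pow_mul_exp_le {c₁ : ℝ} (hc₁ : 160 ≤ c₁) {n : ℕ} (hn : 1 ≤ n) :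
    4 * ((2 : ℝ) ^ n) ^ 3 * Real.exp (-1 / (32 * (1 / (c₁ * n)))) ≤ 1 := by
  have hn' : (1 : ℝ) ≤ n := by exact_mod_cast hn
  have h1 : -1 / (32 * (1 / (c₁ * n))) = -(c₁ * n / 32) := by
    have : c₁ ≠ 0 := by linarith
    have : (n : ℝ) ≠ 0 := by linarith
    field_simp
  have h2 : 5 * (n : ℝ) ≤ c₁ * n / 32 := by nlinarith
  have h3 : (2 : ℝ) ^ (5 * n) ≤ Real.exp (5 * n) := by
    have : Real.exp (5 * n) = Real.exp 1 ^ (5 * n) := by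
      rw [← Real.exp_nat_mul]; push_cast; ring_nf
    rw [this]
    exact pow_le_pow_left₀ (by norm_num) (by linarith [Real.add_one_le_exp (1 : ℝ)]) _
  have h4 : 4 * ((2 : ℝ) ^ n) ^ 3 ≤ 2 ^ (5 * n) := by
    have h5 : (2 : ℝ) ≤ 2 ^ n := by simpa using pow_le_pow_right₀ (one_le_two (α := ℝ)) hn
    have h6 : (2 : ℝ) ^ (5 * n) = (2 ^ n) ^ 2 * (2 ^ n) ^ 3 := by ring
    rw [h6]
    exact mul_le_mul_of_nonneg_right (by nlinarith) (by positivity)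
  rw [h1, Real.exp_neg, ← div_eq_mul_inv, div_le_one (Real.exp_pos _)]
  exact h4.trans (h3.trans (Real.exp_le_exp.2 h2))

theorem mainTheorem7 :
    ∃ c₀ : ℝ, 0 < c₀ ∧ ∀ C : ℝ, 0 < C → ∃ K : ℝ, 0 < K ∧
      ∀ (c₁ : ℝ), c₀ ≤ c₁ → ∀ (n : ℕ), 1 ≤ n → ∀ (ε₀ : ℝ), ε₀ = 1 / (c₁ * n) →
      ∀ (m : ℝ), 0 < m → m ≤ 1 / 2 →
      ∀ (S : Matrix (Fin n → Bool) (Fin n → Bool) ℝ), S.PosSemidef →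
        (∀ i j, |(S * hadamardMatrix n) i j| ≤ C * ε₀ / ((2 : ℝ) ^ n) ^ m) →
        (∀ i j, |S i j| ≤ ε₀) →
        (∀ i j, |(hadamardMatrix n * S * hadamardMatrix n) i j| ≤ ε₀) →
      ∀ (F : SignCube ((Fin n → Bool) ⊕ (Fin n → Bool)) → ℤˣ) (l : ℝ),
        (∀ ρ : (Fin n → Bool) ⊕ (Fin n → Bool) → Option ℤˣ,
          levelMass 2 (restrictBy (fun z => ((F z : ℤ) : ℝ)) ρ) ≤ l) →
        |(∫ z, ((F z : ℤ) : ℝ) ∂(truncatedYes S)) - ∫ z, ((F z : ℤ) : ℝ) ∂(truncatedNo S)|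
          ≤ K * (ε₀ * l / ((2 : ℝ) ^ n) ^ m) := by
  refine ⟨160, by norm_num, fun C hC => ⟨30 * C, by positivity, ?_⟩⟩
  intro c₁ hc₁ n hn ε₀ hε₀ m _ _ S hS hSH hSε hHSH F l hl
  have hn' : (1 : ℝ) ≤ n := by exact_mod_cast hn
  have hcn : 160 ≤ c₁ * n := by nlinarith
  have hε : 0 < ε₀ := by rw [hε₀]; positivity
  have hε' : ε₀ ≤ 1 / 4 := by
    rw [hε₀]
    exact one_div_le_one_div_of_le (by norm_num) (by linarith)
  set H := hadamardMatrix n with hH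
  have hHt : Hᵀ = H := hadamardMatrix_transpose
  have hHSHpos : (H * S * H).PosSemidef := by
    have := hS.mul_mul_conjTranspose_same H
    rwa [conjTranspose_eq_transpose_of_trivial, hHt] at this
  obtain ⟨A, hA, hAS⟩ := exists_multivariateGaussian_eq_map hS
  obtain ⟨B, hB, hBS⟩ := exists_multivariateGaussian_eq_map hHSHpos
  have hBB : B * Bᵀ = (H * A) * (H * A)ᵀ := by
    rw [hB, transpose_mul, hHt, ← hA]
    simp only [Matrix.mul_assoc]
  have hyes : interpolation A B (H * A) (Real.pi / 2) = fromBlocks A 0 (H * A) 0 := by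
    simp [interpolation]
  have hno : interpolation A B (H * A) 0 = fromBlocks A 0 0 B := by
    simp [interpolation]
  have hcross : ∀ i j, |((H * A) * Aᵀ) j i| ≤ C * ε₀ / ((2 : ℝ) ^ n) ^ m := fun i j => by
    have h1 : (H * A) * Aᵀ = (S * H)ᵀ := by
      have hSt : Sᵀ = S := by rw [← hA, transpose_mul, transpose_transpose]
      rw [transpose_mul, hHt, hSt, Matrix.mul_assoc, hA]
    rw [h1]
    exact hSH i j
  have key := abs_integral_biasedCoeff_trnc_sub_le (F := fun z => ((F z : ℤ) : ℝ)) hl (A := A) hBB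
    (v := fun i => (B * Bᵀ) i i) (fun _ => rfl) hε hε'
    (by
      rw [hε₀]
      simpa using four_mul_two_pow_mul_exp_le hc₁ hn)
    (fun i => by rw [hA]; exact (le_abs_self _).trans (hSε i i))
    (fun i => by rw [hB]; exact (le_abs_self _).trans (hHSH i i))
    (by positivity) hcross
  have hlaw : ∀ t, ∫ z, ((F z : ℤ) : ℝ) ∂(truncated (squareSecond
      ((stdGaussianPi ((Fin n → Bool) ⊕ (Fin n → Bool))).map
        fun g => interpolation A B (H * A) t *ᵥ g))) =
      ∫ x, biasedCoeff (fun z => ((F z : ℤ) : ℝ)) ∅ (fun k => trnc (squareShift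
        (fun i => (B * Bᵀ) i i) k ((interpolation A B (H * A) t *ᵥ x) k)))
        ∂(stdGaussianPi ((Fin n → Bool) ⊕ (Fin n → Bool))) := fun t => by
    rw [integral_truncated_squareSecond _ fun z => ((F z : ℤ) : ℝ)]
    simp_rw [interpolation_mul_transpose_inr A hBB]
  rw [truncatedYes, truncatedNo, yesGaussian_eq_map hAS, noGaussian_eq_map hAS hBS, ← hH, ← hyes,
    ← hno, hlaw, hlaw]
  refine key.trans_eq ?_
  ring
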